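/- Let $d,n,N\ge 0$ be integers. A near horizon extremal geometry (NHEG) on a coordinate patch consists of a connected open set $U\subset\mathbb R^d$, a smooth Lorentzian metric $g$ and smooth 1-forms (abelian gauge fields) $A^{(p)}$, $1\le p\le N$, on $U$, with local $SL(2,\mathbb R)\times U(1)^n$ isometry, i.e. with smooth Killing vector fields $\xi_-,\xi_0,\xi_+,\mathrm m_1,\dots,\mathrm m_n$ of $g$ such that $$[\xi_0,\xi_-]=-\xi_-,\quad [\xi_0,\xi_+]=\xi_+,\quad [\xi_-,\xi_+]=\xi_0,\quad [\xi_a,\mathrm m_i]=0,\quad [\mathrm m_i,\mathrm m_j]=0,$$ $\mathscr L_{\xi_-}A^{(p)}=\mathscr L_{\xi_0}A^{(p)}=\mathscr L_{\mathrm m_i}A^{(p)}=0$, and $\mathscr L_{\xi_+}A^{(p)}=\mathrm d\Lambda^p$ for some smooth functions $\Lambda^p$. At each point $\xi_-,\xi_0,\mathrm m_1,\dots,\mathrm m_n$ are linearly independent and their span contains $\xi_+$ and a timelike vector (the orbits are $(n+2)$-dimensional and timelike, and $U$ lies in a Poincaré patch), and $g$ is positive definite on the span of the $\mathrm m_i$.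 Call smooth functions $t,r$ on $U$, $r\neq0$, Poincaré coordinates if $\xi_-$ acts on $(t,r)$ as $\partial_t$, $\xi_0$ as $t\partial_t-r\partial_r$, $\xi_+$ as $\frac12(t^2+\frac1{r^2})\partial_t-tr\,\partial_r$, and every $\mathrm m_i$ as $0$. Given these, define functions $k^i$ and $e^p$ on $U$ by $$g(\xi_-,\mathrm m_j)=r\sum_i k^i\, g(\mathrm m_i,\mathrm m_j),\qquad e^p=\sum_i k^iA^{(p)}(\mathrm m_i)-\frac{A^{(p)}(\xi_-)}{r}$$ (so $g_{t\varphi^j}=r k^i g_{\varphi^i\varphi^j}$ and $A^{(p)}_t=r(A^{(p)}_{\varphi^i}k^i-e^p)$ where $\partial_t=\xi_-$, $\partial_{\varphi^i}=\mathrm m_i$). Put $\mathrm n^-(t,r)=-\frac{t^2r^2-1}{2r}$, $\mathrm n^0(t,r)=tr$, $\mathrm n^+(t,r)=-r$. **NHEG zeroth law.** Every NHEG has Poincaré coordinates with $r>0$. For any Poincaré coordinates $(t,r)$: 1. the functions $k^i$ and $e^p$ are constant on $U$; 2. $\mathrm n^a(t,r)\,\xi_a=\sum_i k^i\mathrm m_i$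 on $U$, i.e. the constants $k^i$ are also those of $\xi_+=\frac12(\frac1{r^2}-t^2)\xi_-+t\,\xi_0-\frac1r\sum_i k^i\mathrm m_i$; 3. for all $t_{\mathcal H}\in\mathbb R$, $r_{\mathcal H}\ne0$, the surface gravity of the Killing vector $\zeta_{\mathcal H}=\mathrm n^a(t_{\mathcal H},r_{\mathcal H})\,\xi_a-\sum_i k^i\mathrm m_i$, i.e. the nonnegative root $$\kappa=\sqrt{-\tfrac18(\mathrm d\zeta_{\mathcal H})_{\alpha\beta}(\mathrm d\zeta_{\mathcal H})^{\alpha\beta}},$$ equals $1$ at every point of the horizon $\mathcal N_{\mathcal H}=\{t+\frac1r=t_{\mathcal H}+\frac1{r_{\mathcal H}}\}\cup\{t-\frac1r=t_{\mathcal H}-\frac1{r_{\mathcal H}}\}$, in particular on $\mathcal H=\{t=t_{\mathcal H},\,r=r_{\mathcal H}\}$. -/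

import Mathlib

open scoped ContDiff

noncomputable section

namespace NearHorizon

/-- Coordinate space of a `d`-dimensional spacetime patch. -/
abbrev Pt (d : ℕ) : Type := Fin d → ℝ

/-- Vector fields in coordinates. -/
abbrev VField (d : ℕ) : Type := Pt d → Pt d

/-- Covector fields (1-forms) in coordinates. -/
abbrev OneForm (d : ℕ) : Type := Pt d → (Pt d →L[ℝ] ℝ)

/-- Covariant 2-tensor fields in coordinates. -/
abbrev TwoTensor (d : ℕ) : Type := Pt d → (Pt d →L[ℝ] Pt d →L[ℝ] ℝ)

/-- Derivative `X(f)` of a function along a vector field. -/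
def along {d : ℕ} (X : VField d) (f : Pt d → ℝ) (x : Pt d) : ℝ :=
  fderiv ℝ f x (X x)

/-- Lie derivative of a covariant 2-tensor:
`(L_X g)_{μν} = X^ρ ∂_ρ g_{μν} + ∂_μ X^ρ g_{ρν} + ∂_ν X^ρ g_{μρ}`. -/
def lieTwo {d : ℕ} (X : VField d) (g : TwoTensor d) (x v w : Pt d) : ℝ :=
  fderiv ℝ g x (X x) v w + g x (fderiv ℝ X x v) w + g x v (fderiv ℝ X x w)

/-- Lie derivative of a 1-form: `(L_X A)_μ = X^ρ ∂_ρ A_μ + ∂_μ X^ρ A_ρ`. -/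
def lieOne {d : ℕ} (X : VField d) (A : OneForm d) (x v : Pt d) : ℝ :=
  fderiv ℝ A x (X x) v + A x (fderiv ℝ X x v)

/-- Exterior derivative of a 1-form: `(dA)_{μν} = ∂_μ A_ν - ∂_ν A_μ`. -/
def extDerivOne {d : ℕ} (A : OneForm d) (x v w : Pt d) : ℝ :=
  fderiv ℝ A x v w - fderiv ℝ A x w v

/-- The 1-form `X_ν = g_{νρ} X^ρ` (for symmetric `g`). -/
def lower {d : ℕ} (g : TwoTensor d) (X : VField d) : OneForm d :=
  fun x => g x (X x)

/-- Coordinate basis vector `∂_μ`. -/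
def basisVec {d : ℕ} (μ : Fin d) : Pt d := Pi.single μ 1

/-- Components `g^{μν}` of the inverse metric. -/
def invMetric {d : ℕ} (g : TwoTensor d) (x : Pt d) : Matrix (Fin d) (Fin d) ℝ :=
  (Matrix.of fun μ ν => g x (basisVec μ) (basisVec ν))⁻¹

/-- The scalar `(dζ)_{αβ} (dζ)^{αβ}` for the 1-form metrically dual to `ζ`. -/
def extDerivSq {d : ℕ} (g : TwoTensor d) (ζ : VField d) (x : Pt d) : ℝ :=
  ∑ α, ∑ β, ∑ μ, ∑ ν, invMetric g x α μ * invMetric g x β ν *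
    extDerivOne (lower g ζ) x (basisVec α) (basisVec β) *
    extDerivOne (lower g ζ) x (basisVec μ) (basisVec ν)

/-- Surface gravity: the nonnegative root of `κ² = -(1/8) (dζ)_{αβ} (dζ)^{αβ}`. -/
def surfaceGravity {d : ℕ} (g : TwoTensor d) (ζ : VField d) (x : Pt d) : ℝ :=
  Real.sqrt (-(1 / 8) * extDerivSq g ζ x)

/-- A symmetric bilinear form of signature `(-,+,…,+)`. -/
def IsLorentzian {d : ℕ} (B : Pt d →L[ℝ] Pt d →L[ℝ] ℝ) : Prop :=
  (∀ v w, B v w = B w v) ∧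
    ∃ v, B v v < 0 ∧ ∀ w, B v w = 0 → w ≠ 0 → 0 < B w w

/-- A near horizon extremal geometry on a coordinate patch `U` of dimension `d`: a Lorentzian
metric and `N` abelian gauge fields with local `SL(2,ℝ) × U(1)^n` isometry.  The `SL(2,ℝ)`
generators are `ξm = ξ₋`, `ξ0 = ξ₀`, `ξp = ξ₊`; the `U(1)^n` generators are `m i`. -/
structure NHEG (d n N : ℕ) where
  U : Set (Pt d)
  isOpen_U : IsOpen U
  isConnected_U : IsConnected U
  g : TwoTensor d
  A : Fin N → OneForm d
  ξm : VField d
  ξ0 : VField d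
  ξp : VField d
  m : Fin n → VField d
  smooth_g : ContDiffOn ℝ ∞ g U
  smooth_A : ∀ p, ContDiffOn ℝ ∞ (A p) U
  smooth_ξm : ContDiffOn ℝ ∞ ξm U
  smooth_ξ0 : ContDiffOn ℝ ∞ ξ0 U
  smooth_ξp : ContDiffOn ℝ ∞ ξp U
  smooth_m : ∀ i, ContDiffOn ℝ ∞ (m i) U
  lorentzian : ∀ x ∈ U, IsLorentzian (g x)
  -- the Lie algebra `sl(2,ℝ) ⊕ u(1)^n`
  bracket_0m : ∀ x ∈ U, VectorField.lieBracket ℝ ξ0 ξm x = -ξm x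
  bracket_0p : ∀ x ∈ U, VectorField.lieBracket ℝ ξ0 ξp x = ξp x
  bracket_mp : ∀ x ∈ U, VectorField.lieBracket ℝ ξm ξp x = ξ0 x
  bracket_ξm_m : ∀ i, ∀ x ∈ U, VectorField.lieBracket ℝ ξm (m i) x = 0
  bracket_ξ0_m : ∀ i, ∀ x ∈ U, VectorField.lieBracket ℝ ξ0 (m i) x = 0
  bracket_ξp_m : ∀ i, ∀ x ∈ U, VectorField.lieBracket ℝ ξp (m i) x = 0
  bracket_m_m : ∀ i j, ∀ x ∈ U, VectorField.lieBracket ℝ (m i) (m j) x = 0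
  -- all generators are Killing vectors
  killing_ξm : ∀ x ∈ U, ∀ v w, lieTwo ξm g x v w = 0
  killing_ξ0 : ∀ x ∈ U, ∀ v w, lieTwo ξ0 g x v w = 0
  killing_ξp : ∀ x ∈ U, ∀ v w, lieTwo ξp g x v w = 0
  killing_m : ∀ i, ∀ x ∈ U, ∀ v w, lieTwo (m i) g x v w = 0
  -- the gauge fields are invariant, under `ξ₊` up to a gauge transformation
  gauge_ξm : ∀ p, ∀ x ∈ U, ∀ v, lieOne ξm (A p) x v = 0
  gauge_ξ0 : ∀ p, ∀ x ∈ U, ∀ v, lieOne ξ0 (A p) x v = 0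
  gauge_m : ∀ p i, ∀ x ∈ U, ∀ v, lieOne (m i) (A p) x v = 0
  gauge_ξp : ∀ p, ∃ Λ : Pt d → ℝ, ContDiffOn ℝ ∞ Λ U ∧
    ∀ x ∈ U, ∀ v, lieOne ξp (A p) x v = fderiv ℝ Λ x v
  -- the orbits of the isometry group are `(n+2)`-dimensional and timelike, with spacelike
  -- `U(1)^n` directions; `ξ₋, ξ₀, m i` frame them on the Poincaré patch
  linearIndependent : ∀ x ∈ U,
    LinearIndependent ℝ (Sum.elim ![ξm x, ξ0 x] (fun i => m i x))
  ξp_mem_orbit : ∀ x ∈ U,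
    ξp x ∈ Submodule.span ℝ (Set.range (Sum.elim ![ξm x, ξ0 x] (fun i => m i x)))
  orbit_timelike : ∀ x ∈ U,
    ∃ v ∈ Submodule.span ℝ (Set.range (Sum.elim ![ξm x, ξ0 x] (fun i => m i x))), g x v v < 0
  m_spacelike : ∀ x ∈ U, ∀ c : Fin n → ℝ, c ≠ 0 →
    0 < g x (∑ i, c i • m i x) (∑ i, c i • m i x)

namespace NHEG

variable {d n N : ℕ} (G : NHEG d n N)

/-- `t, r` are the Poincaré coordinates of the `AdS₂` sector: in coordinates
`(t, r, θ^α, φ^i)` the isometry generators are `ξ₋ = ∂_t`, `ξ₀ = t ∂_t - r ∂_r`,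
`ξ₊ = (1/2)(t² + 1/r²) ∂_t - t r ∂_r + (terms along ∂_{φ^i})`, `m_i = ∂_{φ^i}`. -/
structure IsPoincare (t r : Pt d → ℝ) : Prop where
  smooth_t : ContDiffOn ℝ ∞ t G.U
  smooth_r : ContDiffOn ℝ ∞ r G.U
  r_ne : ∀ x ∈ G.U, r x ≠ 0
  ξm_t : ∀ x ∈ G.U, along G.ξm t x = 1
  ξm_r : ∀ x ∈ G.U, along G.ξm r x = 0
  ξ0_t : ∀ x ∈ G.U, along G.ξ0 t x = t x
  ξ0_r : ∀ x ∈ G.U, along G.ξ0 r x = -r x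
  ξp_t : ∀ x ∈ G.U, along G.ξp t x = (1 / 2) * (t x ^ 2 + 1 / r x ^ 2)
  ξp_r : ∀ x ∈ G.U, along G.ξp r x = -(t x * r x)
  m_t : ∀ i, ∀ x ∈ G.U, along (G.m i) t x = 0
  m_r : ∀ i, ∀ x ∈ G.U, along (G.m i) r x = 0

/-- The components `g_{φ^i φ^j}`. -/
def gPhiPhi (x : Pt d) : Matrix (Fin n) (Fin n) ℝ :=
  Matrix.of fun i j => G.g x (G.m i x) (G.m j x)

/-- The functions `k^i` of the metric, i.e. the solution of
`g_{tφ^j} = r k^i g_{φ^i φ^j}` (with `∂_t = ξ₋`). -/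
def kPot (r : Pt d → ℝ) (x : Pt d) : Fin n → ℝ :=
  (G.gPhiPhi x)⁻¹.mulVec fun j => G.g x (G.ξm x) (G.m j x) / r x

/-- The functions `e^p` of the gauge fields, i.e. the solution of
`A_t = r (A_{φ^i} k^i - e^p)`. -/
def ePot (r : Pt d → ℝ) (p : Fin N) (x : Pt d) : ℝ :=
  ∑ i, G.A p x (G.m i x) * G.kPot r x i - G.A p x (G.ξm x) / r x

/-- The combination `n^a ξ_a`, where `n^- = -(t²r² - 1)/(2r)`, `n^0 = t r`, `n^+ = -r` are
evaluated at the point `(t, r) = (t₀, r₀)` of `AdS₂`. -/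
def nXi (t₀ r₀ : ℝ) : VField d := fun x =>
  (-(t₀ ^ 2 * r₀ ^ 2 - 1) / (2 * r₀)) • G.ξm x + (t₀ * r₀) • G.ξ0 x + (-r₀) • G.ξp x

/-- The horizon Killing vector `ζ_H = n_H^a ξ_a - k^i m_i` of the surface `t = tH, r = rH`. -/
def zetaH (k : Fin n → ℝ) (tH rH : ℝ) : VField d := fun x =>
  G.nXi tH rH x - ∑ i, k i • G.m i x

/-- The bifurcate Killing horizon `t + 1/r = tH + 1/rH` or `t - 1/r = tH - 1/rH`; it contains
the surface `t = tH, r = rH`. -/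
def horizon (t r : Pt d → ℝ) (tH rH : ℝ) : Set (Pt d) :=
  {x ∈ G.U | t x + 1 / r x = tH + 1 / rH ∨ t x - 1 / r x = tH - 1 / rH}

end NHEG

end NearHorizon

end

/-!
Expand `ξ₊ = a ξ₋ + b ξ₀ + c^i m_i` in the orbit frame. The brackets give the derivatives of the
coefficients along the frame, and since the frame fields are Killing, the Killing equation of `ξ₊`
reduces to `da ⊙ ξ₋ + db ⊙ ξ₀ + dc^i ⊙ m_i = 0` (indices lowered). Evaluated on the frame, it makes
`b ξ₋ - ξ₀` and `(2a + b²) ξ₋ + c^i m_i` orthogonal to each other and to all `m_i`, with squared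
norms `W` and `-(2a + b²) W`. As the orbits are Lorentzian, `2a + b² > 0`, and `t = b`,
`r = (2a + b²)^(-1/2)` are Poincaré coordinates. Conversely `a` and `b` are determined by arbitrary
Poincaré coordinates, and on vectors annihilated by `dt` and `dr` the same equation reduces to
`dc^i ⊙ m_i = 0`, so `c^i r` is constant. These constants are `-k^i`.

Put `ρ = 1 / r`. On the orthogonal lifts `R = t ξ₋ - ξ₀` and `S = ρ ξ₋ - k^i m_i` of `-ρ ∂_ρ` and
`ρ ∂_t`, the Killing equation of `ξ₊` forces `R_♭ = -ρ w dρ` and `S_♭ = -ρ w dt`, the metric being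
`w (dρ² - dt²)` on the `AdS₂` directions. The invariance of a gauge field `A` under `ξ₊` reads
`dΛ = A(S) dρ - A(R) dt`; its closedness, with the invariance of `A(S)` along the orbits, makes
`e = -A(S)` constant.

On the horizon branch `τ = τ₀`, with `τ = t ± ρ` null, `ζ_♭ = f dτ + (τ - τ₀) β` gives
`dζ_♭ = (df - β) ∧ dτ`. The square of `α ∧ ℓ_♭` for a null vector `ℓ` is `-2 α(ℓ)²`, and here
`α(ℓ) = ±2` for `ℓ_♭ = dτ`, whence `dζ_{αβ} dζ^{αβ} = -8`.
-/

open scoped ContDiff Topology Matrix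
open VectorField

noncomputable section

namespace NearHorizon

/-! ### Lorentzian forms and contractions with the inverse metric -/

section Lorentzian

variable {d : ℕ} {B : Pt d →L[ℝ] Pt d →L[ℝ] ℝ}

theorem IsLorentzian.pos_of_orthogonal (hB : IsLorentzian B) {v w : Pt d} (hv : B v v < 0)
    (hvw : B v w = 0) (hw : w ≠ 0) : 0 < B w w := by
  obtain ⟨hsymm, v₀, -, hpos⟩ := hB
  have hv₀v : B v₀ v ≠ 0 := fun h => hv.not_gt (hpos v h (by rintro rfl; simp at hv))
  set u : Pt d := B v₀ w • v - B v₀ v • w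
  have hu : B v₀ u = 0 := by
    simp only [u, map_sub, map_smul, smul_eq_mul]
    ring
  have hvu : B v u = B v₀ w * B v v := by simp [u, hvw]
  have huu : B u u = B v₀ w ^ 2 * B v v + B v₀ v ^ 2 * B w w := by
    have hwv : B w v = 0 := by rw [hsymm, hvw]
    simp only [u, map_sub, map_smul, sub_apply, smul_apply, smul_eq_mul, hvw, hwv]
    ring
  by_contra! hww
  have hu0 : u = 0 := by
    by_contra h
    nlinarith [hpos u hu h, sq_nonneg (B v₀ w), sq_nonneg (B v₀ v)]
  have hv₀w : B v₀ w = 0 := by simpa [hu0, hv.ne] using hvu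
  simp [u, hv₀w, hv₀v, hw] at hu0

theorem IsLorentzian.eq_zero_of_forall (hB : IsLorentzian B) {w : Pt d} (h : ∀ v, B v w = 0) :
    w = 0 := by
  obtain ⟨-, v₀, -, hpos⟩ := hB
  by_contra hw
  exact (hpos w (h v₀) hw).ne' (h w)

theorem apply_eq_dotProduct_basisVec (α : Pt d →L[ℝ] ℝ) (v : Pt d) :
    α v = (fun μ => α (basisVec μ)) ⬝ᵥ v := by
  conv_lhs => rw [pi_eq_sum_univ' v, map_sum]
  simp [dotProduct, basisVec, mul_comm, Pi.single]

/-- The contraction `g^{μν} α_μ β_ν` of two covectors with the inverse metric. -/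
def covPairing (g : TwoTensor d) (x : Pt d) (α β : Pt d →L[ℝ] ℝ) : ℝ :=
  (fun μ => α (basisVec μ)) ⬝ᵥ invMetric g x *ᵥ fun ν => β (basisVec ν)

variable {g : TwoTensor d} {x : Pt d}

theorem of_basisVec_mulVec (hg : ∀ v w, g x v w = g x w v) (v : Pt d) :
    (Matrix.of fun μ ν => g x (basisVec μ) (basisVec ν)) *ᵥ v = fun μ => g x v (basisVec μ) := by
  ext μ
  rw [hg, apply_eq_dotProduct_basisVec]
  rfl

theorem covPairing_lower (hg : IsLorentzian (g x)) (α : Pt d →L[ℝ] ℝ) (v : Pt d) :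
    covPairing g x α (g x v) = α v := by
  have hdet : IsUnit (Matrix.of fun μ ν => g x (basisVec μ) (basisVec ν)).det := by
    rw [isUnit_iff_ne_zero, ne_eq, ← Matrix.exists_mulVec_eq_zero_iff]
    rintro ⟨w, hw, hgw⟩
    rw [of_basisVec_mulVec hg.1] at hgw
    refine hw (hg.eq_zero_of_forall fun v => ?_)
    rw [hg.1, apply_eq_dotProduct_basisVec, hgw, zero_dotProduct]
  rw [covPairing, ← of_basisVec_mulVec hg.1, invMetric, Matrix.mulVec_mulVec,
    Matrix.nonsing_inv_mul _ hdet, Matrix.one_mulVec, ← apply_eq_dotProduct_basisVec]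

theorem covPairing_comm (hg : ∀ v w, g x v w = g x w v) (α β : Pt d →L[ℝ] ℝ) :
    covPairing g x α β = covPairing g x β α := by
  have hsymm : (invMetric g x).IsSymm := Matrix.IsSymm.inv (Matrix.IsSymm.ext fun _ _ => hg _ _)
  rw [covPairing, covPairing, Matrix.dotProduct_mulVec, dotProduct_comm, ← Matrix.mulVec_transpose,
    hsymm.eq]

theorem sum_invMetric_mul_invMetric (α β γ δ : Pt d →L[ℝ] ℝ) :
    ∑ κ, ∑ lam, ∑ μ, ∑ ν, invMetric g x κ μ * invMetric g x lam ν *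
      (α (basisVec κ) * β (basisVec lam)) * (γ (basisVec μ) * δ (basisVec ν)) =
    covPairing g x α γ * covPairing g x β δ := by
  rw [covPairing, covPairing, dotProduct, dotProduct, Finset.sum_mul_sum]
  refine Finset.sum_congr rfl fun κ _ => Finset.sum_congr rfl fun lam _ => ?_
  rw [mul_mul_mul_comm, Matrix.mulVec, Matrix.mulVec, dotProduct, dotProduct, Finset.sum_mul_sum,
    Finset.mul_sum]
  refine Finset.sum_congr rfl fun μ _ => ?_
  rw [Finset.mul_sum]
  exact Finset.sum_congr rfl fun ν _ => by ring

theorem extDerivSq_eq_of_wedge {ζ : VField d} {α β : Pt d →L[ℝ] ℝ}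
    (h : ∀ v w, extDerivOne (lower g ζ) x v w = α v * β w - α w * β v) :
    extDerivSq g ζ x = 2 * (covPairing g x α α * covPairing g x β β -
      covPairing g x α β * covPairing g x β α) := by
  calc extDerivSq g ζ x
      = ∑ κ, ∑ lam, ∑ μ, ∑ ν,
          (invMetric g x κ μ * invMetric g x lam ν *
              (α (basisVec κ) * β (basisVec lam)) * (α (basisVec μ) * β (basisVec ν)) -
            invMetric g x κ μ * invMetric g x lam ν *
              (α (basisVec κ) * β (basisVec lam)) * (β (basisVec μ) * α (basisVec ν)) -
            invMetric g x κ μ * invMetric g x lam ν *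
              (β (basisVec κ) * α (basisVec lam)) * (α (basisVec μ) * β (basisVec ν)) +
            invMetric g x κ μ * invMetric g x lam ν *
              (β (basisVec κ) * α (basisVec lam)) * (β (basisVec μ) * α (basisVec ν))) := by
        refine Finset.sum_congr rfl fun _ _ => Finset.sum_congr rfl fun _ _ => ?_
        refine Finset.sum_congr rfl fun _ _ => Finset.sum_congr rfl fun _ _ => ?_
        rw [h, h]
        ring
    _ = _ := by
        simp only [Finset.sum_add_distrib, Finset.sum_sub_distrib, sum_invMetric_mul_invMetric]
        ring

theorem extDerivSq_eq_of_wedge_null (hg : IsLorentzian (g x)) {ζ : VField d} {α : Pt d →L[ℝ] ℝ}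
    {ℓ : Pt d} (hℓ : g x ℓ ℓ = 0)
    (h : ∀ v w, extDerivOne (lower g ζ) x v w = α v * g x ℓ w - α w * g x ℓ v) :
    extDerivSq g ζ x = -2 * α ℓ ^ 2 := by
  rw [extDerivSq_eq_of_wedge h, covPairing_comm hg.1 (g x ℓ) α, covPairing_lower hg,
    covPairing_lower hg, hℓ]
  ring

end Lorentzian

/-! ### Leibniz rules for Lie brackets, Lie derivatives and exterior derivatives -/

section Calculus

variable {E F ι : Type*} [NormedAddCommGroup E] [NormedSpace ℝ E] [NormedAddCommGroup F]
  [NormedSpace ℝ F] [Fintype ι]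

theorem fderiv_sum_smul {f : ι → E → ℝ} {X : ι → E → F} {x : E}
    (hf : ∀ j, DifferentiableAt ℝ (f j) x) (hX : ∀ j, DifferentiableAt ℝ (X j) x) (v : E) :
    fderiv ℝ (fun y => ∑ j, f j y • X j y) x v =
      ∑ j, fderiv ℝ (f j) x v • X j x + ∑ j, f j x • fderiv ℝ (X j) x v := by
  rw [fderiv_fun_sum fun j _ => (hf j).fun_smul (hX j)]
  simp only [sum_apply, ← Finset.sum_add_distrib]
  refine Finset.sum_congr rfl fun j _ => ?_
  rw [fderiv_fun_smul (hf j) (hX j)]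
  simp [add_comm]

theorem fderiv_fun_inv_apply {f : E → ℝ} {x : E} (hf : DifferentiableAt ℝ f x) (hx : f x ≠ 0)
    (v : E) : fderiv ℝ (fun y => (f y)⁻¹) x v = -(f x ^ 2)⁻¹ * fderiv ℝ f x v := by
  have h : HasFDerivAt (fun y => (f y)⁻¹) (-(f x ^ 2)⁻¹ • fderiv ℝ f x) x :=
    (hasDerivAt_inv hx).comp_hasFDerivAt x hf.hasFDerivAt
  rw [h.fderiv]
  rfl

theorem differentiableAt_fderiv {f : E → F} {x : E} (hf : ContDiffAt ℝ 2 f x) :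
    DifferentiableAt ℝ (fderiv ℝ f) x :=
  (hf.fderiv_right (m := 1) (by norm_num)).differentiableAt (by simp)

theorem lieBracket_sum_smul_right {f : ι → E → ℝ} {X : ι → E → E} {x : E}
    (hf : ∀ j, DifferentiableAt ℝ (f j) x) (hX : ∀ j, DifferentiableAt ℝ (X j) x) (Y : E → E) :
    lieBracket ℝ Y (fun y => ∑ j, f j y • X j y) x =
      ∑ j, fderiv ℝ (f j) x (Y x) • X j x + ∑ j, f j x • lieBracket ℝ Y (X j) x := by
  simp only [lieBracket, fderiv_sum_smul hf hX, map_sum, map_smul, smul_sub,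
    Finset.sum_sub_distrib, add_sub_assoc]

theorem contDiffAt_of_eventually_eq_sum_smul [FiniteDimensional ℝ F] {v : ι → E → F} {X : E → F}
    {f : E → ι → ℝ} {x₀ : E} {k : ℕ∞ω} (hv : ∀ i, ContDiffAt ℝ k (v i) x₀)
    (hX : ContDiffAt ℝ k X x₀) (hli : LinearIndependent ℝ fun i => v i x₀)
    (hf : ∀ᶠ x in 𝓝 x₀, X x = ∑ i, f x i • v i x) :
    ContDiffAt ℝ k f x₀ := by
  obtain ⟨S, hS⟩ := LinearMap.exists_leftInverse_of_injective
    (Fintype.linearCombination ℝ fun i => v i x₀)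
    (LinearMap.ker_eq_bot.2 hli.fintypeLinearCombination_injective)
  -- The matrix `R x`, with columns `S (v i x)`, is the identity at `x₀`, so `f = R⁻¹ (S X)` nearby.
  set S' : F →L[ℝ] ι → ℝ := S.toContinuousLinearMap
  set R : E → (ι → ℝ) →L[ℝ] ι → ℝ := fun x =>
    ∑ i, (ContinuousLinearMap.proj (R := ℝ) (φ := fun _ : ι => ℝ) i).smulRight (S' (v i x))
  have hR : ContDiffAt ℝ k R x₀ := ContDiffAt.sum fun i _ =>
    contDiffAt_const.smulRight (S'.contDiff.contDiffAt.comp x₀ (hv i))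
  have hR₀ : R x₀ = (1 : ((ι → ℝ) →L[ℝ] ι → ℝ)ˣ) := by
    ext1 c
    simpa [R, S', Fintype.linearCombination_apply] using LinearMap.congr_fun hS c
  have hinv : ContDiffAt ℝ k (fun x => Ring.inverse (R x)) x₀ := by
    have h := contDiffAt_ringInverse (n := k) ℝ (1 : ((ι → ℝ) →L[ℝ] ι → ℝ)ˣ)
    rw [← hR₀] at h
    exact h.comp x₀ hR
  have hunit : ∀ᶠ x in 𝓝 x₀, IsUnit (R x) :=
    hR.continuousAt.eventually_mem (by rw [hR₀]; exact Units.nhds _)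
  refine (hinv.clm_apply (S'.contDiff.contDiffAt.comp x₀ hX)).congr_of_eventuallyEq ?_
  filter_upwards [hunit, hf] with x hx hfx
  have hRf : R x (f x) = S' (X x) := by simp [R, hfx]
  rw [Function.comp_apply, ← hRf, ← mul_apply_eq_comp, Ring.inverse_mul_cancel _ hx,
    one_apply_eq_self]

variable {d : ℕ} {x : Pt d}

theorem lieTwo_congr {X Y : VField d} (h : X =ᶠ[𝓝 x] Y) (g : TwoTensor d) (v w : Pt d) :
    lieTwo X g x v w = lieTwo Y g x v w := by
  rw [lieTwo, lieTwo, h.fderiv_eq, h.eq_of_nhds]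

theorem lieOne_congr {X Y : VField d} (h : X =ᶠ[𝓝 x] Y) (A : OneForm d) (v : Pt d) :
    lieOne X A x v = lieOne Y A x v := by
  rw [lieOne, lieOne, h.fderiv_eq, h.eq_of_nhds]

theorem lieTwo_sum_smul {f : ι → Pt d → ℝ} {X : ι → VField d} (g : TwoTensor d)
    (hf : ∀ j, DifferentiableAt ℝ (f j) x) (hX : ∀ j, DifferentiableAt ℝ (X j) x) (v w : Pt d) :
    lieTwo (fun y => ∑ j, f j y • X j y) g x v w =
      ∑ j, (fderiv ℝ (f j) x v * g x (X j x) w + fderiv ℝ (f j) x w * g x v (X j x)) +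
        ∑ j, f j x * lieTwo (X j) g x v w := by
  simp only [lieTwo, fderiv_sum_smul hf hX, map_add, map_sum, map_smul, add_apply, sum_apply,
    smul_apply, smul_eq_mul, mul_add, Finset.sum_add_distrib]
  ring

theorem lieOne_sum_smul {f : ι → Pt d → ℝ} {X : ι → VField d} (A : OneForm d)
    (hf : ∀ j, DifferentiableAt ℝ (f j) x) (hX : ∀ j, DifferentiableAt ℝ (X j) x) (v : Pt d) :
    lieOne (fun y => ∑ j, f j y • X j y) A x v =
      ∑ j, fderiv ℝ (f j) x v * A x (X j x) + ∑ j, f j x * lieOne (X j) A x v := by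
  simp only [lieOne, fderiv_sum_smul hf hX, map_add, map_sum, map_smul, sum_apply,
    smul_apply, smul_eq_mul, mul_add, Finset.sum_add_distrib]
  ring

theorem fderiv_oneForm_apply {A : OneForm d} {X Y : VField d} (hA : DifferentiableAt ℝ A x)
    (hY : DifferentiableAt ℝ Y x) :
    fderiv ℝ (fun y => A y (Y y)) x (X x) = lieOne X A x (Y x) + A x (lieBracket ℝ X Y x) := by
  rw [fderiv_clm_apply hA hY]
  simp only [add_apply, ContinuousLinearMap.comp_apply, ContinuousLinearMap.flip_apply, lieOne,
    lieBracket, map_sub]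
  ring

theorem fderiv_twoTensor_apply {g : TwoTensor d} {X Y Z : VField d} (hg : DifferentiableAt ℝ g x)
    (hY : DifferentiableAt ℝ Y x) (hZ : DifferentiableAt ℝ Z x) :
    fderiv ℝ (fun y => g y (Y y) (Z y)) x (X x) = lieTwo X g x (Y x) (Z x) +
      g x (lieBracket ℝ X Y x) (Z x) + g x (Y x) (lieBracket ℝ X Z x) := by
  rw [fderiv_clm_apply (hg.clm_apply hY) hZ, fderiv_clm_apply hg hY]
  simp only [ContinuousLinearMap.flip_add, add_apply, ContinuousLinearMap.comp_apply,
    ContinuousLinearMap.flip_apply, lieTwo, lieBracket, map_sub, sub_apply]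
  ring

theorem extDerivOne_congr {A B : OneForm d} (h : A =ᶠ[𝓝 x] B) (v w : Pt d) :
    extDerivOne A x v w = extDerivOne B x v w := by
  rw [extDerivOne, extDerivOne, h.fderiv_eq]

theorem extDerivOne_add {A B : OneForm d} (hA : DifferentiableAt ℝ A x)
    (hB : DifferentiableAt ℝ B x) (v w : Pt d) :
    extDerivOne (fun y => A y + B y) x v w = extDerivOne A x v w + extDerivOne B x v w := by
  simp only [extDerivOne, fderiv_fun_add hA hB, add_apply]
  ring

theorem extDerivOne_smul {f : Pt d → ℝ} {A : OneForm d} (hf : DifferentiableAt ℝ f x)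
    (hA : DifferentiableAt ℝ A x) (v w : Pt d) :
    extDerivOne (fun y => f y • A y) x v w =
      fderiv ℝ f x v * A x w - fderiv ℝ f x w * A x v + f x * extDerivOne A x v w := by
  simp only [extDerivOne, fderiv_fun_smul hf hA, add_apply, smul_apply,
    ContinuousLinearMap.smulRight_apply, smul_eq_mul]
  ring

theorem extDerivOne_fderiv {f : Pt d → ℝ} (hf : ContDiffAt ℝ 2 f x) (v w : Pt d) :
    extDerivOne (fderiv ℝ f) x v w = 0 :=
  sub_eq_zero.2 (hf.isSymmSndFDerivAt (by simp) v w)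

theorem extDerivOne_smul_fderiv_add_smul {f τ : Pt d → ℝ} {A B : OneForm d} {a : ℝ}
    (hf : DifferentiableAt ℝ f x) (hτ : ContDiffAt ℝ 2 τ x) (hB : DifferentiableAt ℝ B x)
    (hA : A =ᶠ[𝓝 x] fun y => f y • fderiv ℝ τ y + (τ y - a) • B y) (ha : τ x = a) (v w : Pt d) :
    extDerivOne A x v w =
      (fderiv ℝ f x - B x) v * fderiv ℝ τ x w - (fderiv ℝ f x - B x) w * fderiv ℝ τ x v := by
  have hdτ := differentiableAt_fderiv hτ
  have hτa : DifferentiableAt ℝ (fun y => τ y - a) x :=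
    (hτ.differentiableAt (by simp)).sub_const a
  rw [extDerivOne_congr hA, extDerivOne_add (hf.fun_smul hdτ) (hτa.fun_smul hB),
    extDerivOne_smul hf hdτ, extDerivOne_smul hτa hB, extDerivOne_fderiv hτ, fderiv_sub_const, ha]
  simp only [sub_apply]
  ring

end Calculus

namespace NHEG

/-! ### The orbit frame and the coefficients of `ξ₊` -/

section Frame

variable {d n N : ℕ} (G : NHEG d n N)

/-- The frame `ξ₋, ξ₀, m i` of the orbits. -/
def frame : Fin 2 ⊕ Fin n → VField d := Sum.elim ![G.ξm, G.ξ0] G.m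

variable {G} {x : Pt d}

theorem frame_apply : (fun j => G.frame j x) = Sum.elim ![G.ξm x, G.ξ0 x] fun i => G.m i x := by
  funext j
  rcases j with j | i
  · fin_cases j <;> rfl
  · rfl

theorem sum_smul_frame (f : Fin 2 ⊕ Fin n → ℝ) : ∑ j, f j • G.frame j x =
    f (.inl 0) • G.ξm x + f (.inl 1) • G.ξ0 x + ∑ i, f (.inr i) • G.m i x := by
  simp [frame, Fintype.sum_sum_type, Fin.sum_univ_two]

theorem contDiffAt_g (hx : x ∈ G.U) : ContDiffAt ℝ ∞ G.g x :=
  G.smooth_g.contDiffAt (G.isOpen_U.mem_nhds hx)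

theorem contDiffAt_A (p : Fin N) (hx : x ∈ G.U) : ContDiffAt ℝ ∞ (G.A p) x :=
  (G.smooth_A p).contDiffAt (G.isOpen_U.mem_nhds hx)

theorem contDiffAt_ξm (hx : x ∈ G.U) : ContDiffAt ℝ ∞ G.ξm x :=
  G.smooth_ξm.contDiffAt (G.isOpen_U.mem_nhds hx)

theorem contDiffAt_ξ0 (hx : x ∈ G.U) : ContDiffAt ℝ ∞ G.ξ0 x :=
  G.smooth_ξ0.contDiffAt (G.isOpen_U.mem_nhds hx)

theorem contDiffAt_m (i : Fin n) (hx : x ∈ G.U) : ContDiffAt ℝ ∞ (G.m i) x :=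
  (G.smooth_m i).contDiffAt (G.isOpen_U.mem_nhds hx)

theorem contDiffAt_frame (j : Fin 2 ⊕ Fin n) (hx : x ∈ G.U) : ContDiffAt ℝ ∞ (G.frame j) x := by
  rcases j with j | i
  · fin_cases j
    · exact contDiffAt_ξm hx
    · exact contDiffAt_ξ0 hx
  · exact contDiffAt_m i hx

theorem lieTwo_frame (j : Fin 2 ⊕ Fin n) (hx : x ∈ G.U) (v w : Pt d) :
    lieTwo (G.frame j) G.g x v w = 0 := by
  rcases j with j | i
  · fin_cases j
    · exact G.killing_ξm x hx v w
    · exact G.killing_ξ0 x hx v w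
  · exact G.killing_m i x hx v w

theorem lieOne_frame (p : Fin N) (j : Fin 2 ⊕ Fin n) (hx : x ∈ G.U) (v : Pt d) :
    lieOne (G.frame j) (G.A p) x v = 0 := by
  rcases j with j | i
  · fin_cases j
    · exact G.gauge_ξm p x hx v
    · exact G.gauge_ξ0 p x hx v
  · exact G.gauge_m p i x hx v

theorem lieBracket_ξm_ξ0 (hx : x ∈ G.U) : lieBracket ℝ G.ξm G.ξ0 x = G.ξm x := by
  rw [lieBracket_swap, G.bracket_0m x hx, neg_neg]

theorem lieBracket_m_ξm (i : Fin n) (hx : x ∈ G.U) : lieBracket ℝ (G.m i) G.ξm x = 0 := by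
  rw [lieBracket_swap, G.bracket_ξm_m i x hx, neg_zero]

theorem lieBracket_m_ξ0 (i : Fin n) (hx : x ∈ G.U) : lieBracket ℝ (G.m i) G.ξ0 x = 0 := by
  rw [lieBracket_swap, G.bracket_ξ0_m i x hx, neg_zero]

theorem lieBracket_m_ξp (i : Fin n) (hx : x ∈ G.U) : lieBracket ℝ (G.m i) G.ξp x = 0 := by
  rw [lieBracket_swap, G.bracket_ξp_m i x hx, neg_zero]

theorem eq_zero_of_frame_eq_zero (hx : x ∈ G.U) {α β : ℝ} {γ : Fin n → ℝ}
    (h : α • G.ξm x + β • G.ξ0 x + ∑ i, γ i • G.m i x = 0) : α = 0 ∧ β = 0 ∧ ∀ i, γ i = 0 := by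
  have hli := Fintype.linearIndependent_iff.1 (frame_apply ▸ G.linearIndependent x hx)
    (Sum.elim ![α, β] γ) ((sum_smul_frame _).trans h)
  exact ⟨hli (.inl 0), hli (.inl 1), fun i => hli (.inr i)⟩

theorem exists_frame_coeffs {v : Pt d}
    (hv : v ∈ Submodule.span ℝ (Set.range (Sum.elim ![G.ξm x, G.ξ0 x] fun i => G.m i x))) :
    ∃ f : Fin 2 ⊕ Fin n → ℝ, v = ∑ j, f j • G.frame j x := by
  rw [← frame_apply, Submodule.mem_span_range_iff_exists_fun] at hv
  exact hv.imp fun _ => Eq.symm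

theorem differentiableAt_frameCoeffs {a b : Pt d → ℝ} {c : Fin n → Pt d → ℝ}
    (ha : DifferentiableAt ℝ a x) (hb : DifferentiableAt ℝ b x)
    (hc : ∀ i, DifferentiableAt ℝ (c i) x) (j : Fin 2 ⊕ Fin n) :
    DifferentiableAt ℝ ((Sum.elim ![a, b] c : Fin 2 ⊕ Fin n → Pt d → ℝ) j) x := by
  rcases j with j | i
  · fin_cases j
    · exact ha
    · exact hb
  · exact hc i

theorem lieBracket_frameCombination {a b : Pt d → ℝ} {c : Fin n → Pt d → ℝ} (hx : x ∈ G.U)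
    (ha : DifferentiableAt ℝ a x) (hb : DifferentiableAt ℝ b x)
    (hc : ∀ i, DifferentiableAt ℝ (c i) x) (Y : VField d) :
    lieBracket ℝ Y (fun y => a y • G.ξm y + b y • G.ξ0 y + ∑ i, c i y • G.m i y) x =
      fderiv ℝ a x (Y x) • G.ξm x + fderiv ℝ b x (Y x) • G.ξ0 x +
          ∑ i, fderiv ℝ (c i) x (Y x) • G.m i x +
        (a x • lieBracket ℝ Y G.ξm x + b x • lieBracket ℝ Y G.ξ0 x +
          ∑ i, c i x • lieBracket ℝ Y (G.m i) x) := by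
  have h := lieBracket_sum_smul_right (differentiableAt_frameCoeffs ha hb hc)
    (fun j => (contDiffAt_frame j hx).differentiableAt (by simp)) Y
  simpa [frame, Fintype.sum_sum_type, Fin.sum_univ_two] using h

variable (G) in
/-- The functions `a`, `b`, `c i` are the coefficients of `ξ₊` in the orbit frame. -/
structure OrbitCoeffs (a b : Pt d → ℝ) (c : Fin n → Pt d → ℝ) : Prop where
  smooth_a : ∀ x ∈ G.U, ContDiffAt ℝ ∞ a x
  smooth_b : ∀ x ∈ G.U, ContDiffAt ℝ ∞ b x
  smooth_c : ∀ i, ∀ x ∈ G.U, ContDiffAt ℝ ∞ (c i) x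
  ξp_eq : ∀ x ∈ G.U, G.ξp x = a x • G.ξm x + b x • G.ξ0 x + ∑ i, c i x • G.m i x

variable (G) in
theorem exists_orbitCoeffs : ∃ a b c, G.OrbitCoeffs a b c := by
  choose! f hf using fun x hx => exists_frame_coeffs (G.ξp_mem_orbit x hx)
  have hsmooth : ∀ j, ∀ x ∈ G.U, ContDiffAt ℝ ∞ (fun y => f y j) x := fun j x hx =>
    contDiffAt_pi.1 (contDiffAt_of_eventually_eq_sum_smul (fun j => contDiffAt_frame j hx)
      (G.smooth_ξp.contDiffAt (G.isOpen_U.mem_nhds hx)) (frame_apply ▸ G.linearIndependent x hx)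
      (Filter.eventually_of_mem (G.isOpen_U.mem_nhds hx) hf)) j
  exact ⟨fun x => f x (.inl 0), fun x => f x (.inl 1), fun i x => f x (.inr i),
    hsmooth _, hsmooth _, fun i => hsmooth _, fun x hx => (hf x hx).trans (sum_smul_frame _)⟩

variable (G) in
/-- The field `b ξ₋ - ξ₀`. When `b` is the `ξ₀`-coefficient of `ξ₊`, which is the coordinate `t`,
it is orthogonal to `ξ₋` and all `m i`. -/
def radial (b : Pt d → ℝ) : VField d := fun x => b x • G.ξm x - G.ξ0 x

namespace OrbitCoeffs

variable {a b : Pt d → ℝ} {c : Fin n → Pt d → ℝ} (h : G.OrbitCoeffs a b c)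
include h

theorem differentiableAt (hx : x ∈ G.U) (j : Fin 2 ⊕ Fin n) :
    DifferentiableAt ℝ ((Sum.elim ![a, b] c : Fin 2 ⊕ Fin n → Pt d → ℝ) j) x :=
  differentiableAt_frameCoeffs ((h.smooth_a x hx).differentiableAt (by simp))
    ((h.smooth_b x hx).differentiableAt (by simp))
    (fun i => (h.smooth_c i x hx).differentiableAt (by simp)) j

theorem ξp_eventuallyEq (hx : x ∈ G.U) :
    G.ξp =ᶠ[𝓝 x] fun y =>
      ∑ j, (Sum.elim ![a, b] c : Fin 2 ⊕ Fin n → Pt d → ℝ) j y • G.frame j y := by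
  filter_upwards [G.isOpen_U.mem_nhds hx] with y hy
  rw [h.ξp_eq y hy, sum_smul_frame fun j => (Sum.elim ![a, b] c : Fin 2 ⊕ Fin n → Pt d → ℝ) j y]
  rfl

theorem lieBracket_ξp (hx : x ∈ G.U) (Y : VField d) : lieBracket ℝ Y G.ξp x =
    fderiv ℝ a x (Y x) • G.ξm x + fderiv ℝ b x (Y x) • G.ξ0 x +
        ∑ i, fderiv ℝ (c i) x (Y x) • G.m i x +
      (a x • lieBracket ℝ Y G.ξm x + b x • lieBracket ℝ Y G.ξ0 x +
        ∑ i, c i x • lieBracket ℝ Y (G.m i) x) := by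
  rw [Filter.EventuallyEq.rfl.lieBracket_vectorField_eq
    (Filter.eventually_of_mem (G.isOpen_U.mem_nhds hx) h.ξp_eq)]
  exact lieBracket_frameCombination hx (h.differentiableAt hx (.inl 0))
    (h.differentiableAt hx (.inl 1)) (fun i => h.differentiableAt hx (.inr i)) Y

theorem fderiv_ξm (hx : x ∈ G.U) : fderiv ℝ a x (G.ξm x) = -b x ∧ fderiv ℝ b x (G.ξm x) = 1 ∧
    ∀ i, fderiv ℝ (c i) x (G.ξm x) = 0 := by
  have hbr := h.lieBracket_ξp hx G.ξm
  simp only [G.bracket_mp x hx, lieBracket_self, lieBracket_ξm_ξ0 hx, G.bracket_ξm_m _ x hx,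
    Pi.zero_apply, smul_zero, Finset.sum_const_zero] at hbr
  obtain ⟨ha, hb, hc⟩ := eq_zero_of_frame_eq_zero hx (α := fderiv ℝ a x (G.ξm x) + b x)
    (β := fderiv ℝ b x (G.ξm x) - 1) (γ := fun i => fderiv ℝ (c i) x (G.ξm x))
    (by linear_combination (norm := module) -hbr)
  exact ⟨by linarith, by linarith, hc⟩

theorem fderiv_ξ0 (hx : x ∈ G.U) : fderiv ℝ a x (G.ξ0 x) = 2 * a x ∧
    fderiv ℝ b x (G.ξ0 x) = b x ∧ ∀ i, fderiv ℝ (c i) x (G.ξ0 x) = c i x := by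
  have hbr := h.lieBracket_ξp hx G.ξ0
  simp only [G.bracket_0p x hx, h.ξp_eq x hx, lieBracket_self, G.bracket_0m x hx,
    G.bracket_ξ0_m _ x hx, Pi.zero_apply, smul_zero, Finset.sum_const_zero] at hbr
  obtain ⟨ha, hb, hc⟩ := eq_zero_of_frame_eq_zero hx (α := fderiv ℝ a x (G.ξ0 x) - 2 * a x)
    (β := fderiv ℝ b x (G.ξ0 x) - b x) (γ := fun i => fderiv ℝ (c i) x (G.ξ0 x) - c i x) (by
      simp only [sub_smul, Finset.sum_sub_distrib]
      linear_combination (norm := module) -hbr)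
  exact ⟨by linarith, by linarith, fun i => by linarith [hc i]⟩

theorem fderiv_m (hx : x ∈ G.U) (j : Fin n) : fderiv ℝ a x (G.m j x) = 0 ∧
    fderiv ℝ b x (G.m j x) = 0 ∧ ∀ i, fderiv ℝ (c i) x (G.m j x) = 0 := by
  have hbr := h.lieBracket_ξp hx (G.m j)
  simp only [lieBracket_m_ξp j hx, lieBracket_m_ξm j hx, lieBracket_m_ξ0 j hx,
    G.bracket_m_m _ _ x hx, smul_zero, Finset.sum_const_zero, add_zero] at hbr
  exact eq_zero_of_frame_eq_zero hx hbr.symm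

theorem killing (hx : x ∈ G.U) (v w : Pt d) :
    fderiv ℝ a x v * G.g x (G.ξm x) w + fderiv ℝ b x v * G.g x (G.ξ0 x) w +
        ∑ i, fderiv ℝ (c i) x v * G.g x (G.m i x) w +
      (fderiv ℝ a x w * G.g x (G.ξm x) v + fderiv ℝ b x w * G.g x (G.ξ0 x) v +
        ∑ i, fderiv ℝ (c i) x w * G.g x (G.m i x) v) = 0 := by
  have hξp := G.killing_ξp x hx v w
  rw [lieTwo_congr (h.ξp_eventuallyEq hx),
    lieTwo_sum_smul G.g (h.differentiableAt hx) fun j =>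
      (contDiffAt_frame j hx).differentiableAt (by simp)] at hξp
  simp only [lieTwo_frame _ hx, mul_zero, Finset.sum_const_zero, add_zero,
    (G.lorentzian x hx).1 v, Finset.sum_add_distrib, Fintype.sum_sum_type, Fin.sum_univ_two] at hξp
  exact hξp

theorem lieOne_ξp (p : Fin N) (hx : x ∈ G.U) (v : Pt d) : lieOne G.ξp (G.A p) x v =
    fderiv ℝ a x v * G.A p x (G.ξm x) + fderiv ℝ b x v * G.A p x (G.ξ0 x) +
      ∑ i, fderiv ℝ (c i) x v * G.A p x (G.m i x) := by
  rw [lieOne_congr (h.ξp_eventuallyEq hx),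
    lieOne_sum_smul (G.A p) (h.differentiableAt hx) fun j =>
      (contDiffAt_frame j hx).differentiableAt (by simp)]
  simp only [lieOne_frame p _ hx, mul_zero, Finset.sum_const_zero, add_zero]
  simp [frame, Fintype.sum_sum_type, Fin.sum_univ_two]

end OrbitCoeffs

end Frame

/-! ### Existence of Poincaré coordinates -/

section Existence

variable {d n N : ℕ} {G : NHEG d n N} {x : Pt d}

variable (G) in
/-- The field `f ξ₋ + c^i m_i`. For suitable `f`, `c` it is orthogonal to all `m i`, and then it
spans the `AdS₂` directions together with `radial`. -/
def temporal (f : Pt d → ℝ) (c : Fin n → Pt d → ℝ) : VField d :=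
  fun x => f x • G.ξm x + ∑ i, c i x • G.m i x

/-- The function `2 a + b²`: it is `1 / r²` because `ξ₊` has coefficients `a = (1 / r² - t²) / 2`
and `b = t` in the orbit frame. -/
def discr (a b : Pt d → ℝ) : Pt d → ℝ := fun x => 2 * a x + b x ^ 2

theorem sum_smul_m_nonneg (hx : x ∈ G.U) (y : Fin n → ℝ) :
    0 ≤ G.g x (∑ i, y i • G.m i x) (∑ i, y i • G.m i x) := by
  rcases eq_or_ne y 0 with rfl | hy
  · simp
  · exact (G.m_spacelike x hx y hy).le

theorem apply_sum_m_eq_zero {v : Pt d} (hv : ∀ j, G.g x v (G.m j x) = 0) (y : Fin n → ℝ) :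
    G.g x v (∑ i, y i • G.m i x) = 0 := by
  simp [hv]

theorem eq_zero_of_forall_sum_m (hx : x ∈ G.U) {y : Fin n → ℝ}
    (hy : ∀ j, G.g x (∑ i, y i • G.m i x) (G.m j x) = 0) : y = 0 := by
  by_contra hne
  exact (G.m_spacelike x hx y hne).ne' (apply_sum_m_eq_zero hy y)

theorem apply_temporal {v : Pt d} (hv : ∀ j, G.g x v (G.m j x) = 0) (f : Pt d → ℝ)
    (c : Fin n → Pt d → ℝ) : G.g x v (G.temporal f c x) = f x * G.g x v (G.ξm x) := by
  rw [temporal, map_add, map_smul, apply_sum_m_eq_zero hv, add_zero, smul_eq_mul]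

namespace OrbitCoeffs

variable {a b : Pt d → ℝ} {c : Fin n → Pt d → ℝ} (h : G.OrbitCoeffs a b c)
include h

theorem radial_ξm (hx : x ∈ G.U) : G.g x (G.radial b x) (G.ξm x) = 0 := by
  obtain ⟨ha, hb, hc⟩ := h.fderiv_ξm hx
  have hk := h.killing hx (G.ξm x) (G.ξm x)
  simp only [ha, hb, hc, zero_mul, Finset.sum_const_zero] at hk
  simp only [radial, map_sub, map_smul, sub_apply, smul_apply, smul_eq_mul]
  linarith

theorem radial_m (hx : x ∈ G.U) (j : Fin n) : G.g x (G.radial b x) (G.m j x) = 0 := by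
  obtain ⟨ha, hb, hc⟩ := h.fderiv_ξm hx
  obtain ⟨ha', hb', hc'⟩ := h.fderiv_m hx j
  have hk := h.killing hx (G.ξm x) (G.m j x)
  simp only [ha, hb, hc, ha', hb', hc', zero_mul, Finset.sum_const_zero] at hk
  simp only [radial, map_sub, map_smul, sub_apply, smul_apply, smul_eq_mul]
  linarith

theorem temporal_m (hx : x ∈ G.U) (j : Fin n) :
    G.g x (G.temporal (discr a b) c x) (G.m j x) = 0 := by
  obtain ⟨ha, hb, hc⟩ := h.fderiv_ξ0 hx
  obtain ⟨ha', hb', hc'⟩ := h.fderiv_m hx j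
  have hk := h.killing hx (G.ξ0 x) (G.m j x)
  have hr := h.radial_m hx j
  simp only [ha, hb, hc, ha', hb', hc', zero_mul, Finset.sum_const_zero] at hk
  simp only [radial, map_sub, map_smul, sub_apply, smul_apply, smul_eq_mul] at hr
  simp only [temporal, discr, map_add, map_sum, map_smul, add_apply, sum_apply, smul_apply,
    smul_eq_mul]
  linear_combination hk + b x * hr

theorem temporal_ξm (hx : x ∈ G.U) :
    G.g x (G.temporal (discr a b) c x) (G.ξm x) = -G.g x (G.radial b x) (G.radial b x) := by
  obtain ⟨ha, hb, hc⟩ := h.fderiv_ξm hx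
  obtain ⟨ha', hb', hc'⟩ := h.fderiv_ξ0 hx
  have hk := h.killing hx (G.ξm x) (G.ξ0 x)
  have hr := h.radial_ξm hx
  simp only [ha, hb, hc, ha', hb', hc', zero_mul, Finset.sum_const_zero,
    (G.lorentzian x hx).1 (G.ξm x)] at hk
  simp only [radial, map_sub, map_smul, sub_apply, smul_apply, smul_eq_mul] at hr ⊢
  rw [(G.lorentzian x hx).1 (G.ξm x) (G.ξ0 x)]
  simp only [temporal, discr, map_add, map_sum, map_smul, add_apply, sum_apply, smul_apply,
    smul_eq_mul]
  linear_combination hk + 2 * b x * hr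

theorem temporal_temporal (hx : x ∈ G.U) :
    G.g x (G.temporal (discr a b) c x) (G.temporal (discr a b) c x) =
      -(discr a b x * G.g x (G.radial b x) (G.radial b x)) := by
  rw [apply_temporal (h.temporal_m hx), h.temporal_ξm hx, mul_neg]

theorem radial_temporal (hx : x ∈ G.U) (f : Pt d → ℝ) (γ : Fin n → Pt d → ℝ) :
    G.g x (G.radial b x) (G.temporal f γ x) = 0 := by
  rw [apply_temporal (h.radial_m hx), h.radial_ξm hx, mul_zero]

theorem radial_radial_ne_zero (hx : x ∈ G.U) : G.g x (G.radial b x) (G.radial b x) ≠ 0 := by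
  intro hW
  have hξ0 : G.g x (G.radial b x) (G.ξ0 x) = 0 := by
    rw [radial, map_sub, ← radial, map_smul, h.radial_ξm hx] at hW
    simpa using hW
  obtain ⟨v, hv, hvneg⟩ := G.orbit_timelike x hx
  obtain ⟨f, rfl⟩ := exists_frame_coeffs hv
  have horth : G.g x (∑ j, f j • G.frame j x) (G.radial b x) = 0 := by
    rw [(G.lorentzian x hx).1, sum_smul_frame]
    simp [h.radial_ξm hx, h.radial_m hx, hξ0]
  refine ((G.lorentzian x hx).pos_of_orthogonal hvneg horth fun h0 => ?_).ne' hW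
  have := (eq_zero_of_frame_eq_zero hx (α := b x) (β := -1) (γ := 0)
    (by simpa [radial, sub_eq_add_neg] using h0)).2.1
  norm_num at this

theorem discr_ne_zero (hx : x ∈ G.U) : discr a b x ≠ 0 := by
  intro hD
  have hT : G.temporal (discr a b) c x = ∑ i, c i x • G.m i x := by simp [temporal, hD]
  have hc : (fun i => c i x) = 0 :=
    eq_zero_of_forall_sum_m hx fun j => by rw [← hT]; exact h.temporal_m hx j
  refine h.radial_radial_ne_zero hx (neg_eq_zero.1 ?_)
  simp [← h.temporal_ξm hx, hT, funext_iff.1 hc]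

theorem discr_sq_mul_orbit (hx : x ∈ G.U) (f : Fin 2 ⊕ Fin n → ℝ) :
    ∃ u v : ℝ, discr a b x ^ 2 * G.g x (∑ j, f j • G.frame j x) (∑ j, f j • G.frame j x) ≥
      (u ^ 2 - discr a b x * v ^ 2) * G.g x (G.radial b x) (G.radial b x) := by
  have hs := (G.lorentzian x hx).1
  set v := f (.inl 0) + f (.inl 1) * b x
  set u := -(discr a b x * f (.inl 1))
  set T := G.temporal (discr a b) c x
  set R := G.radial b x
  set M := ∑ i, (discr a b x * f (.inr i) - v * c i x) • G.m i x
  have hv : discr a b x • ∑ j, f j • G.frame j x = u • R + v • T + M := by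
    simp only [T, R, M, sum_smul_frame, radial, temporal, sub_smul, mul_smul,
      Finset.sum_sub_distrib, ← Finset.smul_sum]
    module
  have hRM : G.g x R M = 0 := apply_sum_m_eq_zero (h.radial_m hx) _
  have hTM : G.g x T M = 0 := apply_sum_m_eq_zero (h.temporal_m hx) _
  have hRT : G.g x R T = 0 := h.radial_temporal hx _ _
  have hTT : G.g x T T = -(discr a b x * G.g x R R) := h.temporal_temporal hx
  refine ⟨u, v, ?_⟩
  calc discr a b x ^ 2 * G.g x (∑ j, f j • G.frame j x) (∑ j, f j • G.frame j x)
      = G.g x (u • R + v • T + M) (u • R + v • T + M) := by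
        rw [← hv]
        simp only [map_smul, smul_apply, smul_eq_mul]
        ring
    _ = (u ^ 2 - discr a b x * v ^ 2) * G.g x R R + G.g x M M := by
        simp only [map_add, map_smul, add_apply, smul_apply, smul_eq_mul, hs M, hs T R,
          hRM, hTM, hRT, hTT]
        ring
    _ ≥ _ := le_add_of_nonneg_right (sum_smul_m_nonneg hx _)

theorem discr_pos (hx : x ∈ G.U) : 0 < discr a b x := by
  obtain ⟨w, hw, hwneg⟩ := G.orbit_timelike x hx
  obtain ⟨f, rfl⟩ := exists_frame_coeffs hw
  obtain ⟨u, v, huv⟩ := h.discr_sq_mul_orbit hx f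
  have hD0 := h.discr_ne_zero hx
  by_contra! hD
  -- For negative `2 a + b²` the orthogonal fields `radial` and `temporal` would both be timelike.
  have hR : G.g x (G.radial b x) (G.radial b x) < 0 := by
    have hcoeff : 0 ≤ u ^ 2 - discr a b x * v ^ 2 := by
      nlinarith [sq_nonneg u, mul_nonneg (neg_nonneg.2 hD) (sq_nonneg v)]
    exact neg_of_mul_neg_right (huv.trans_lt (mul_neg_of_pos_of_neg (by positivity) hwneg)) hcoeff
  have hT : G.temporal (discr a b) c x ≠ 0 := fun h0 => h.radial_radial_ne_zero hx <| by
    simpa [h0] using h.temporal_ξm hx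
  have hTT := (G.lorentzian x hx).pos_of_orthogonal hR (h.radial_temporal hx _ c) hT
  rw [h.temporal_temporal hx] at hTT
  nlinarith

end OrbitCoeffs

end Existence

section HalfPlane

variable {d n N : ℕ} (G : NHEG d n N)

/-- Poincaré coordinates with `ρ = 1 / r` in place of `r`: in the half-plane coordinates `(t, ρ)` of
`AdS₂` the generators act as `ξ₋ = ∂_t`, `ξ₀ = t ∂_t + ρ ∂_ρ`,
`ξ₊ = (1/2)(t² + ρ²) ∂_t + t ρ ∂_ρ`. -/
structure IsHalfPlane (t ρ : Pt d → ℝ) : Prop where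
  smooth_t : ∀ x ∈ G.U, ContDiffAt ℝ ∞ t x
  smooth_ρ : ∀ x ∈ G.U, ContDiffAt ℝ ∞ ρ x
  ρ_ne : ∀ x ∈ G.U, ρ x ≠ 0
  ξm_t : ∀ x ∈ G.U, fderiv ℝ t x (G.ξm x) = 1
  ξm_ρ : ∀ x ∈ G.U, fderiv ℝ ρ x (G.ξm x) = 0
  ξ0_t : ∀ x ∈ G.U, fderiv ℝ t x (G.ξ0 x) = t x
  ξ0_ρ : ∀ x ∈ G.U, fderiv ℝ ρ x (G.ξ0 x) = ρ x
  ξp_t : ∀ x ∈ G.U, fderiv ℝ t x (G.ξp x) = (t x ^ 2 + ρ x ^ 2) / 2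
  ξp_ρ : ∀ x ∈ G.U, fderiv ℝ ρ x (G.ξp x) = t x * ρ x
  m_t : ∀ i, ∀ x ∈ G.U, fderiv ℝ t x (G.m i x) = 0
  m_ρ : ∀ i, ∀ x ∈ G.U, fderiv ℝ ρ x (G.m i x) = 0

variable {G} {t ρ : Pt d → ℝ} {x : Pt d}

theorem IsPoincare.isHalfPlane {r : Pt d → ℝ} (h : G.IsPoincare t r) :
    G.IsHalfPlane t fun x => (r x)⁻¹ := by
  have ht : ∀ x ∈ G.U, ContDiffAt ℝ ∞ t x := fun x hx =>
    h.smooth_t.contDiffAt (G.isOpen_U.mem_nhds hx)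
  have hr : ∀ x ∈ G.U, ContDiffAt ℝ ∞ r x := fun x hx =>
    h.smooth_r.contDiffAt (G.isOpen_U.mem_nhds hx)
  have hinv : ∀ (X : VField d), ∀ x ∈ G.U,
      fderiv ℝ (fun y => (r y)⁻¹) x (X x) = -(r x ^ 2)⁻¹ * along X r x := fun X x hx =>
    fderiv_fun_inv_apply ((hr x hx).differentiableAt (by simp)) (h.r_ne x hx) (X x)
  exact
    { smooth_t := ht
      smooth_ρ := fun x hx => (hr x hx).inv (h.r_ne x hx)
      ρ_ne := fun x hx => inv_ne_zero (h.r_ne x hx)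
      ξm_t := h.ξm_t
      ξm_ρ := fun x hx => by rw [hinv _ x hx, h.ξm_r x hx, mul_zero]
      ξ0_t := h.ξ0_t
      ξ0_ρ := fun x hx => by
        have := h.r_ne x hx
        rw [hinv _ x hx, h.ξ0_r x hx]
        field_simp
      ξp_t := fun x hx => by
        refine (h.ξp_t x hx).trans ?_
        ring
      ξp_ρ := fun x hx => by
        have := h.r_ne x hx
        rw [hinv _ x hx, h.ξp_r x hx]
        field_simp
      m_t := h.m_t
      m_ρ := fun i x hx => by rw [hinv _ x hx, h.m_r i x hx, mul_zero] }

namespace IsHalfPlane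

theorem isPoincare (h : G.IsHalfPlane t ρ) : G.IsPoincare t fun x => (ρ x)⁻¹ := by
  have hinv : ∀ (X : VField d), ∀ x ∈ G.U,
      along X (fun y => (ρ y)⁻¹) x = -(ρ x ^ 2)⁻¹ * fderiv ℝ ρ x (X x) := fun X x hx =>
    fderiv_fun_inv_apply ((h.smooth_ρ x hx).differentiableAt (by simp)) (h.ρ_ne x hx) (X x)
  exact
    { smooth_t := fun x hx => (h.smooth_t x hx).contDiffWithinAt
      smooth_r := fun x hx => ((h.smooth_ρ x hx).inv (h.ρ_ne x hx)).contDiffWithinAt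
      r_ne := fun x hx => inv_ne_zero (h.ρ_ne x hx)
      ξm_t := h.ξm_t
      ξm_r := fun x hx => by rw [hinv _ x hx, h.ξm_ρ x hx, mul_zero]
      ξ0_t := h.ξ0_t
      ξ0_r := fun x hx => by
        have := h.ρ_ne x hx
        rw [hinv _ x hx, h.ξ0_ρ x hx]
        field_simp
      ξp_t := fun x hx => by
        refine (h.ξp_t x hx).trans ?_
        rw [inv_pow, one_div, one_div, inv_inv]
        ring
      ξp_r := fun x hx => by
        have := h.ρ_ne x hx
        rw [hinv _ x hx, h.ξp_ρ x hx]
        field_simp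
      m_t := h.m_t
      m_r := fun i x hx => by rw [hinv _ x hx, h.m_ρ i x hx, mul_zero] }

end IsHalfPlane

namespace OrbitCoeffs

variable {a b : Pt d → ℝ} {c : Fin n → Pt d → ℝ} (h : G.OrbitCoeffs a b c)
include h

theorem apply_ξp (hx : x ∈ G.U) (T : Pt d →L[ℝ] ℝ) :
    T (G.ξp x) = a x * T (G.ξm x) + b x * T (G.ξ0 x) + ∑ i, c i x * T (G.m i x) := by
  simp [h.ξp_eq x hx]

theorem fderiv_sqrt_discr (hx : x ∈ G.U) (v : Pt d) : fderiv ℝ (fun y => √(discr a b y)) x v =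
    (fderiv ℝ a x v + b x * fderiv ℝ b x v) / √(discr a b x) := by
  have ha := ((h.smooth_a x hx).differentiableAt (by simp)).hasFDerivAt
  have hb := ((h.smooth_b x hx).differentiableAt (by simp)).hasFDerivAt
  have hD : HasFDerivAt (discr a b) ((2 : ℝ) • fderiv ℝ a x + (2 * b x) • fderiv ℝ b x) x := by
    refine HasFDerivAt.congr_fderiv ((ha.const_mul 2).add (hb.pow 2)) ?_
    simp
  rw [(hD.sqrt (h.discr_pos hx).ne').fderiv]
  simp only [add_apply, smul_apply, smul_eq_mul]
  ring

theorem isHalfPlane : G.IsHalfPlane b fun x => √(discr a b x) where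
  smooth_t := h.smooth_b
  smooth_ρ x hx := ContDiffAt.sqrt
    ((contDiffAt_const.mul (h.smooth_a x hx)).add ((h.smooth_b x hx).pow 2)) (h.discr_pos hx).ne'
  ρ_ne x hx := (Real.sqrt_pos.2 (h.discr_pos hx)).ne'
  ξm_t x hx := (h.fderiv_ξm hx).2.1
  ξm_ρ x hx := by
    rw [h.fderiv_sqrt_discr hx, (h.fderiv_ξm hx).1, (h.fderiv_ξm hx).2.1]
    simp
  ξ0_t x hx := (h.fderiv_ξ0 hx).2.1
  ξ0_ρ x hx := by
    rw [h.fderiv_sqrt_discr hx, (h.fderiv_ξ0 hx).1, (h.fderiv_ξ0 hx).2.1, ← sq]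
    exact Real.div_sqrt
  ξp_t x hx := by
    rw [h.apply_ξp hx, Real.sq_sqrt (h.discr_pos hx).le, (h.fderiv_ξm hx).2.1,
      (h.fderiv_ξ0 hx).2.1, discr]
    simp only [(h.fderiv_m hx _).2.1, mul_zero, Finset.sum_const_zero]
    ring
  ξp_ρ x hx := by
    have hD : discr a b x / √(discr a b x) = √(discr a b x) := Real.div_sqrt
    rw [h.fderiv_sqrt_discr hx, h.apply_ξp hx, h.apply_ξp hx, (h.fderiv_ξm hx).1,
      (h.fderiv_ξm hx).2.1, (h.fderiv_ξ0 hx).1, (h.fderiv_ξ0 hx).2.1]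
    simp only [(h.fderiv_m hx _).1, (h.fderiv_m hx _).2.1, mul_zero, Finset.sum_const_zero]
    calc _ = b x * (discr a b x / √(discr a b x)) := by
          rw [discr]
          ring
      _ = _ := by rw [hD]
  m_t i x hx := (h.fderiv_m hx i).2.1
  m_ρ i x hx := by
    rw [h.fderiv_sqrt_discr hx, (h.fderiv_m hx i).1, (h.fderiv_m hx i).2.1]
    simp

end OrbitCoeffs

end HalfPlane

/-! ### The normal form of `ξ₊` -/

section NormalForm

variable {d n N : ℕ} {G : NHEG d n N} {t ρ : Pt d → ℝ} {x : Pt d}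

namespace IsHalfPlane

variable (h : G.IsHalfPlane t ρ)
include h

theorem differentiableAt_t (hx : x ∈ G.U) : DifferentiableAt ℝ t x :=
  (h.smooth_t x hx).differentiableAt (by simp)

theorem differentiableAt_ρ (hx : x ∈ G.U) : DifferentiableAt ℝ ρ x :=
  (h.smooth_ρ x hx).differentiableAt (by simp)

theorem covector_eq_zero (hx : x ∈ G.U) {T : Pt d →L[ℝ] ℝ} (hξm : T (G.ξm x) = 0)
    (hξ0 : T (G.ξ0 x) = 0)
    (hT : ∀ v, fderiv ℝ t x v = 0 → fderiv ℝ ρ x v = 0 → T v = 0) : T = 0 := by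
  have hρ := h.ρ_ne x hx
  ext v
  set β := fderiv ℝ ρ x v / ρ x
  set α := fderiv ℝ t x v - β * t x
  have hv := hT (v - α • G.ξm x - β • G.ξ0 x)
    (by simp [α, h.ξm_t x hx, h.ξ0_t x hx]) (by simp [β, h.ξm_ρ x hx, h.ξ0_ρ x hx, hρ])
  simpa [hξm, hξ0] using hv

theorem exists_eq_const {f : Pt d → ℝ} (hf : ∀ x ∈ G.U, DifferentiableAt ℝ f x)
    (hξm : ∀ x ∈ G.U, fderiv ℝ f x (G.ξm x) = 0) (hξ0 : ∀ x ∈ G.U, fderiv ℝ f x (G.ξ0 x) = 0)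
    (hv : ∀ x ∈ G.U, ∀ v, fderiv ℝ t x v = 0 → fderiv ℝ ρ x v = 0 → fderiv ℝ f x v = 0) :
    ∃ C, ∀ x ∈ G.U, f x = C :=
  G.isOpen_U.exists_is_const_of_fderiv_eq_zero G.isConnected_U.isPreconnected
    (fun x hx => (hf x hx).differentiableWithinAt)
    (fun x hx => h.covector_eq_zero hx (hξm x hx) (hξ0 x hx) (hv x hx))

theorem fderiv_half_sq_sub_sq (hx : x ∈ G.U) (v : Pt d) :
    fderiv ℝ (fun y => (ρ y ^ 2 - t y ^ 2) / 2) x v =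
      ρ x * fderiv ℝ ρ x v - t x * fderiv ℝ t x v := by
  have hfun : HasFDerivAt (fun y => (ρ y ^ 2 - t y ^ 2) / 2)
      ((2⁻¹ : ℝ) • ((2 * ρ x) • fderiv ℝ ρ x - (2 * t x) • fderiv ℝ t x)) x := by
    refine HasFDerivAt.congr_fderiv ((((h.differentiableAt_ρ hx).hasFDerivAt.pow 2).sub
      ((h.differentiableAt_t hx).hasFDerivAt.pow 2)).mul_const 2⁻¹) ?_
    simp
  rw [hfun.fderiv]
  simp only [sub_apply, smul_apply, smul_eq_mul]
  ring

theorem orbitCoeffs {a b : Pt d → ℝ} {c : Fin n → Pt d → ℝ} (hO : G.OrbitCoeffs a b c) :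
    G.OrbitCoeffs (fun x => (ρ x ^ 2 - t x ^ 2) / 2) t c where
  smooth_a x hx := (((h.smooth_ρ x hx).pow 2).sub ((h.smooth_t x hx).pow 2)).div_const 2
  smooth_b := h.smooth_t
  smooth_c := hO.smooth_c
  ξp_eq x hx := by
    have hρ := hO.apply_ξp hx (fderiv ℝ ρ x)
    have ht := hO.apply_ξp hx (fderiv ℝ t x)
    simp only [h.ξp_ρ x hx, h.ξm_ρ x hx, h.ξ0_ρ x hx, h.m_ρ _ x hx, mul_zero, zero_add,
      Finset.sum_const_zero, add_zero] at hρ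
    simp only [h.ξp_t x hx, h.ξm_t x hx, h.ξ0_t x hx, h.m_t _ x hx, mul_zero, mul_one,
      Finset.sum_const_zero, add_zero] at ht
    have hb : b x = t x := (mul_right_cancel₀ (h.ρ_ne x hx) hρ).symm
    have ha : a x = (ρ x ^ 2 - t x ^ 2) / 2 := by
      rw [hb] at ht
      linarith
    rw [hO.ξp_eq x hx, ha, hb]

theorem fderiv_coeff_eq_zero {c : Fin n → Pt d → ℝ}
    (hO : G.OrbitCoeffs (fun x => (ρ x ^ 2 - t x ^ 2) / 2) t c) (hx : x ∈ G.U) {v : Pt d}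
    (ht : fderiv ℝ t x v = 0) (hρ : fderiv ℝ ρ x v = 0) (i : Fin n) :
    fderiv ℝ (c i) x v = 0 := by
  refine congrFun (eq_zero_of_forall_sum_m (y := fun i => fderiv ℝ (c i) x v) hx fun j => ?_) i
  have hk := hO.killing hx v (G.m j x)
  simp only [h.fderiv_half_sq_sub_sq hx, h.m_t j x hx, h.m_ρ j x hx, ht, hρ,
    (hO.fderiv_m hx j).2.2, mul_zero, sub_zero, zero_mul, zero_add, add_zero,
    Finset.sum_const_zero] at hk
  simpa using hk

theorem exists_coeff_eq_mul_const {c : Fin n → Pt d → ℝ}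
    (hO : G.OrbitCoeffs (fun x => (ρ x ^ 2 - t x ^ 2) / 2) t c) (i : Fin n) :
    ∃ C, ∀ x ∈ G.U, c i x = ρ x * C := by
  have hc : ∀ x ∈ G.U, DifferentiableAt ℝ (c i) x := fun x hx =>
    (hO.smooth_c i x hx).differentiableAt (by simp)
  have hquot : ∀ x ∈ G.U, ∀ v, fderiv ℝ (fun y => c i y * (ρ y)⁻¹) x v =
      fderiv ℝ (c i) x v / ρ x - c i x * fderiv ℝ ρ x v / ρ x ^ 2 := fun x hx v => by
    have hρ := h.differentiableAt_ρ hx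
    rw [fderiv_fun_mul (hc x hx) (hρ.fun_inv (h.ρ_ne x hx))]
    simp only [add_apply, smul_apply, smul_eq_mul, fderiv_fun_inv_apply hρ (h.ρ_ne x hx)]
    ring
  obtain ⟨C, hC⟩ := h.exists_eq_const (f := fun y => c i y * (ρ y)⁻¹)
    (fun x hx => (hc x hx).mul ((h.differentiableAt_ρ hx).inv (h.ρ_ne x hx)))
    (fun x hx => by simp [hquot x hx, (hO.fderiv_ξm hx).2.2 i, h.ξm_ρ x hx])
    (fun x hx => by
      have hρ := h.ρ_ne x hx
      rw [hquot x hx, (hO.fderiv_ξ0 hx).2.2 i, h.ξ0_ρ x hx]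
      field_simp
      simp)
    (fun x hx v ht hρ => by simp [hquot x hx, h.fderiv_coeff_eq_zero hO hx ht hρ i, hρ])
  exact ⟨C, fun x hx => by rw [← hC x hx, mul_comm, inv_mul_cancel_right₀ (h.ρ_ne x hx)]⟩

end IsHalfPlane

variable (G) in
/-- Half-plane coordinates `(t, ρ)` together with the constants `k` of the normal form
`ξ₊ = (1/2)(ρ² - t²) ξ₋ + t ξ₀ - ρ k^i m_i`. -/
structure IsNormalForm (t ρ : Pt d → ℝ) (k : Fin n → ℝ) : Prop extends G.IsHalfPlane t ρ where
  ξp_eq : ∀ x ∈ G.U, G.ξp x =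
    ((ρ x ^ 2 - t x ^ 2) / 2) • G.ξm x + t x • G.ξ0 x - ρ x • ∑ i, k i • G.m i x

theorem IsHalfPlane.exists_isNormalForm (h : G.IsHalfPlane t ρ) : ∃ k, G.IsNormalForm t ρ k := by
  obtain ⟨a, b, c, hO⟩ := G.exists_orbitCoeffs
  choose C hC using h.exists_coeff_eq_mul_const (h.orbitCoeffs hO)
  refine ⟨fun i => -C i, h, fun x hx => ?_⟩
  rw [(h.orbitCoeffs hO).ξp_eq x hx, sub_eq_add_neg _ (ρ x • _), ← smul_neg,
    ← Finset.sum_neg_distrib, Finset.smul_sum]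
  simp only [hC _ x hx, neg_smul, neg_neg, mul_smul]

theorem IsNormalForm.orbitCoeffs {k : Fin n → ℝ} (h : G.IsNormalForm t ρ k) :
    G.OrbitCoeffs (fun x => (ρ x ^ 2 - t x ^ 2) / 2) t fun i x => ρ x * -k i where
  smooth_a x hx := (((h.smooth_ρ x hx).pow 2).sub ((h.smooth_t x hx).pow 2)).div_const 2
  smooth_b := h.smooth_t
  smooth_c _ x hx := (h.smooth_ρ x hx).mul contDiffAt_const
  ξp_eq x hx := by
    simp only [h.ξp_eq x hx, mul_smul, ← Finset.smul_sum, neg_smul, Finset.sum_neg_distrib,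
      smul_neg, sub_eq_add_neg]

end NormalForm

/-! ### The `AdS₂` part of the metric and of the gauge fields -/

section Horizontal

variable {d n N : ℕ} {G : NHEG d n N} {t ρ : Pt d → ℝ} {k : Fin n → ℝ} {x : Pt d}

variable (G) in
/-- The field `ρ ξ₋ - k^i m_i`, the lift of `ρ ∂_t` orthogonal to all `m_i`. In the same way
`radial t` is the orthogonal lift of `-ρ ∂_ρ`. -/
def horizontal (ρ : Pt d → ℝ) (k : Fin n → ℝ) : VField d :=
  fun x => ρ x • G.ξm x - ∑ i, k i • G.m i x

variable (G) in
/-- The conformal factor `w` of the `AdS₂` part `w (dρ² - dt²)` of the metric. -/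
def conformalFactor (t ρ : Pt d → ℝ) : Pt d → ℝ :=
  fun x => G.g x (G.radial t x) (G.radial t x) / ρ x ^ 2

theorem contDiffAt_sum_m (k : Fin n → ℝ) (hx : x ∈ G.U) :
    ContDiffAt ℝ ∞ (fun y => ∑ i, k i • G.m i y) x :=
  ContDiffAt.sum fun i _ => contDiffAt_const.fun_smul (contDiffAt_m i hx)

theorem smul_horizontal (t ρ : Pt d → ℝ) (k : Fin n → ℝ) :
    (fun y => ρ y • G.horizontal ρ k y) = G.temporal (discr (fun y => (ρ y ^ 2 - t y ^ 2) / 2) t)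
      fun i y => ρ y * -k i := by
  funext y
  simp only [horizontal, temporal, discr, smul_sub, mul_neg, neg_smul, mul_smul,
    Finset.sum_neg_distrib, ← Finset.smul_sum]
  module

namespace IsHalfPlane

variable (h : G.IsHalfPlane t ρ)
include h

theorem contDiffAt_radial (hx : x ∈ G.U) : ContDiffAt ℝ ∞ (G.radial t) x :=
  ((h.smooth_t x hx).smul (contDiffAt_ξm hx)).sub (contDiffAt_ξ0 hx)

theorem contDiffAt_horizontal (k : Fin n → ℝ) (hx : x ∈ G.U) :
    ContDiffAt ℝ ∞ (G.horizontal ρ k) x :=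
  ((h.smooth_ρ x hx).smul (contDiffAt_ξm hx)).sub (contDiffAt_sum_m k hx)

theorem contDiffAt_conformalFactor (hx : x ∈ G.U) :
    ContDiffAt ℝ ∞ (G.conformalFactor t ρ) x :=
  ((contDiffAt_g hx).clm_apply (h.contDiffAt_radial hx) |>.clm_apply (h.contDiffAt_radial hx)).div
    ((h.smooth_ρ x hx).pow 2) (pow_ne_zero 2 (h.ρ_ne x hx))

theorem fderiv_radial (hx : x ∈ G.U) :
    fderiv ℝ t x (G.radial t x) = 0 ∧ fderiv ℝ ρ x (G.radial t x) = -ρ x := by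
  simp [radial, h.ξm_t x hx, h.ξ0_t x hx, h.ξm_ρ x hx, h.ξ0_ρ x hx]

theorem fderiv_horizontal (k : Fin n → ℝ) (hx : x ∈ G.U) :
    fderiv ℝ t x (G.horizontal ρ k x) = ρ x ∧ fderiv ℝ ρ x (G.horizontal ρ k x) = 0 := by
  simp [horizontal, h.ξm_t x hx, h.m_t _ x hx, h.ξm_ρ x hx, h.m_ρ _ x hx]

theorem lieBracket_frame_radial (j : Fin 2 ⊕ Fin n) (hx : x ∈ G.U) :
    lieBracket ℝ (G.frame j) (G.radial t) x = 0 := by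
  have hcomb : G.radial t = fun y =>
      t y • G.ξm y + (-1 : ℝ) • G.ξ0 y + ∑ i, (0 : ℝ) • G.m i y := by
    funext y
    simp [radial, sub_eq_add_neg]
  rw [hcomb, lieBracket_frameCombination hx (h.differentiableAt_t hx)
    (differentiableAt_const _) fun _ => differentiableAt_const _]
  rcases j with j | j
  · fin_cases j
    · simp [frame, h.ξm_t x hx, lieBracket_ξm_ξ0 hx]
    · simp [frame, h.ξ0_t x hx, G.bracket_0m x hx]
  · simp [frame, h.m_t j x hx, lieBracket_m_ξm j hx, lieBracket_m_ξ0 j hx]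

theorem lieBracket_frame_horizontal (k : Fin n → ℝ) (j : Fin 2 ⊕ Fin n) (hx : x ∈ G.U) :
    lieBracket ℝ (G.frame j) (G.horizontal ρ k) x = 0 := by
  have hcomb : G.horizontal ρ k = fun y =>
      ρ y • G.ξm y + (0 : ℝ) • G.ξ0 y + ∑ i, -k i • G.m i y := by
    funext y
    simp [horizontal, sub_eq_add_neg]
  rw [hcomb, lieBracket_frameCombination hx (h.differentiableAt_ρ hx)
    (differentiableAt_const _) fun _ => differentiableAt_const _]
  rcases j with j | j
  · fin_cases j
    · simp [frame, h.ξm_ρ x hx, G.bracket_ξm_m _ x hx]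
    · simp [frame, h.ξ0_ρ x hx, G.bracket_0m x hx, G.bracket_ξ0_m _ x hx]
  · simp [frame, h.m_ρ j x hx, lieBracket_m_ξm j hx, G.bracket_m_m j _ x hx]

theorem fderiv_radial_radial_frame (j : Fin 2 ⊕ Fin n) (hx : x ∈ G.U) :
    fderiv ℝ (fun y => G.g y (G.radial t y) (G.radial t y)) x (G.frame j x) = 0 := by
  have hR := (h.contDiffAt_radial hx).differentiableAt (by simp)
  rw [fderiv_twoTensor_apply ((contDiffAt_g hx).differentiableAt (by simp)) hR hR,
    lieTwo_frame j hx, h.lieBracket_frame_radial j hx]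
  simp

theorem fderiv_conformalFactor_frame (j : Fin 2 ⊕ Fin n) (hx : x ∈ G.U) :
    fderiv ℝ (G.conformalFactor t ρ) x (G.frame j x) =
      -2 * G.conformalFactor t ρ x * (fderiv ℝ ρ x (G.frame j x) / ρ x) := by
  have hρ := h.ρ_ne x hx
  have hW : DifferentiableAt ℝ (fun y => G.g y (G.radial t y) (G.radial t y)) x :=
    ((contDiffAt_g hx).clm_apply (h.contDiffAt_radial hx) |>.clm_apply
      (h.contDiffAt_radial hx)).differentiableAt (by simp)
  have hρ2 : DifferentiableAt ℝ (fun y => ρ y ^ 2) x := (h.differentiableAt_ρ hx).fun_pow 2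
  have hw : G.conformalFactor t ρ = fun y =>
      G.g y (G.radial t y) (G.radial t y) * (ρ y ^ 2)⁻¹ := rfl
  rw [hw, fderiv_fun_mul hW (hρ2.fun_inv (pow_ne_zero 2 hρ))]
  simp only [add_apply, smul_apply, smul_eq_mul, h.fderiv_radial_radial_frame j hx,
    fderiv_fun_inv_apply hρ2 (pow_ne_zero 2 hρ), fderiv_fun_pow 2 (h.differentiableAt_ρ hx)]
  field_simp
  simp only [nsmul_eq_mul]
  ring

theorem fderiv_conformalFactor_radial (hx : x ∈ G.U) :
    fderiv ℝ (G.conformalFactor t ρ) x (G.radial t x) = 2 * G.conformalFactor t ρ x := by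
  have hρ := h.ρ_ne x hx
  have hξm := h.fderiv_conformalFactor_frame (.inl 0) hx
  have hξ0 := h.fderiv_conformalFactor_frame (.inl 1) hx
  simp only [frame, Sum.elim_inl, Matrix.cons_val_zero, Matrix.cons_val_one, h.ξm_ρ x hx,
    h.ξ0_ρ x hx] at hξm hξ0
  rw [radial, map_sub, map_smul, hξm, hξ0]
  field_simp
  simp

theorem fderiv_conformalFactor_horizontal (k : Fin n → ℝ) (hx : x ∈ G.U) :
    fderiv ℝ (G.conformalFactor t ρ) x (G.horizontal ρ k x) = 0 := by
  have hξm := h.fderiv_conformalFactor_frame (.inl 0) hx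
  have hm := fun i => h.fderiv_conformalFactor_frame (.inr i) hx
  simp only [frame, Sum.elim_inl, Sum.elim_inr, Matrix.cons_val_zero, h.ξm_ρ x hx,
    h.m_ρ _ x hx] at hξm hm
  simp [horizontal, hξm, hm]

end IsHalfPlane

namespace IsNormalForm

variable (h : G.IsNormalForm t ρ k)
include h

theorem radial_m (hx : x ∈ G.U) (j : Fin n) : G.g x (G.radial t x) (G.m j x) = 0 :=
  h.orbitCoeffs.radial_m hx j

theorem horizontal_m (hx : x ∈ G.U) (j : Fin n) : G.g x (G.horizontal ρ k x) (G.m j x) = 0 := by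
  have hT := h.orbitCoeffs.temporal_m hx j
  rw [← smul_horizontal] at hT
  simpa [h.ρ_ne x hx] using hT

theorem radial_horizontal (hx : x ∈ G.U) :
    G.g x (G.radial t x) (G.horizontal ρ k x) = 0 := by
  rw [horizontal, map_sub, map_smul, h.orbitCoeffs.radial_ξm hx,
    apply_sum_m_eq_zero (h.radial_m hx)]
  simp

theorem horizontal_horizontal (hx : x ∈ G.U) :
    G.g x (G.horizontal ρ k x) (G.horizontal ρ k x) = -G.g x (G.radial t x) (G.radial t x) := by
  have hT := h.orbitCoeffs.temporal_ξm hx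
  rw [← smul_horizontal] at hT
  nth_rw 2 [horizontal]
  rw [map_sub, apply_sum_m_eq_zero (h.horizontal_m hx), ← hT]
  simp

theorem fderiv_coeffs_mul (hx : x ∈ G.U) (v : Pt d) (T : Pt d →L[ℝ] ℝ) :
    fderiv ℝ (fun y => (ρ y ^ 2 - t y ^ 2) / 2) x v * T (G.ξm x) + fderiv ℝ t x v * T (G.ξ0 x) +
        ∑ i, fderiv ℝ (fun y => ρ y * -k i) x v * T (G.m i x) =
      fderiv ℝ ρ x v * T (G.horizontal ρ k x) - fderiv ℝ t x v * T (G.radial t x) := by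
  simp only [h.fderiv_half_sq_sub_sq hx, fderiv_mul_const (h.differentiableAt_ρ hx), horizontal,
    radial, map_sub, map_sum, map_smul, smul_apply, smul_eq_mul, mul_sub, Finset.mul_sum,
    neg_mul, Finset.sum_neg_distrib]
  ring_nf

theorem killing_ξp (hx : x ∈ G.U) (v w : Pt d) :
    fderiv ℝ ρ x v * G.g x (G.horizontal ρ k x) w - fderiv ℝ t x v * G.g x (G.radial t x) w +
      (fderiv ℝ ρ x w * G.g x (G.horizontal ρ k x) v -
        fderiv ℝ t x w * G.g x (G.radial t x) v) = 0 := by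
  have hk := h.orbitCoeffs.killing hx v w
  simpa only [(G.lorentzian x hx).1 _ v, (G.lorentzian x hx).1 _ w, h.fderiv_coeffs_mul hx]
    using hk

theorem conformalFactor_ne_zero (hx : x ∈ G.U) : G.conformalFactor t ρ x ≠ 0 :=
  div_ne_zero (h.orbitCoeffs.radial_radial_ne_zero hx) (pow_ne_zero 2 (h.ρ_ne x hx))

theorem g_horizontal (hx : x ∈ G.U) : G.g x (G.horizontal ρ k x) =
    -(ρ x * G.conformalFactor t ρ x) • fderiv ℝ t x := by
  have hρ := h.ρ_ne x hx
  ext v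
  have hk := h.killing_ξp hx v (G.radial t x)
  rw [(h.fderiv_radial hx).1, (h.fderiv_radial hx).2, (G.lorentzian x hx).1 (G.horizontal ρ k x),
    h.radial_horizontal hx] at hk
  simp only [conformalFactor, smul_apply, smul_eq_mul]
  field_simp
  linarith

theorem g_radial (hx : x ∈ G.U) : G.g x (G.radial t x) =
    -(ρ x * G.conformalFactor t ρ x) • fderiv ℝ ρ x := by
  have hρ := h.ρ_ne x hx
  ext v
  have hk := h.killing_ξp hx v (G.horizontal ρ k x)
  rw [(h.fderiv_horizontal k hx).1, (h.fderiv_horizontal k hx).2, h.radial_horizontal hx,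
    h.horizontal_horizontal hx] at hk
  simp only [conformalFactor, smul_apply, smul_eq_mul]
  field_simp
  linarith

theorem fderiv_A_horizontal_frame (p : Fin N) (j : Fin 2 ⊕ Fin n) (hx : x ∈ G.U) :
    fderiv ℝ (fun y => G.A p y (G.horizontal ρ k y)) x (G.frame j x) = 0 := by
  rw [fderiv_oneForm_apply ((contDiffAt_A p hx).differentiableAt (by simp))
    ((h.contDiffAt_horizontal k hx).differentiableAt (by simp)), lieOne_frame p j hx,
    h.lieBracket_frame_horizontal k j hx]
  simp

theorem fderiv_A_horizontal_eq_zero (p : Fin N) (hx : x ∈ G.U) {v : Pt d}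
    (ht : fderiv ℝ t x v = 0) (hρ : fderiv ℝ ρ x v = 0) :
    fderiv ℝ (fun y => G.A p y (G.horizontal ρ k y)) x v = 0 := by
  obtain ⟨Λ, hΛ, hξp⟩ := G.gauge_ξp p
  have hU := G.isOpen_U.mem_nhds hx
  have hdΛ : fderiv ℝ Λ =ᶠ[𝓝 x] fun y => G.A p y (G.horizontal ρ k y) • fderiv ℝ ρ y +
      -G.A p y (G.radial t y) • fderiv ℝ t y := by
    filter_upwards [hU] with y hy
    ext w
    rw [← hξp y hy, h.orbitCoeffs.lieOne_ξp p hy, h.fderiv_coeffs_mul hy]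
    simp only [add_apply, smul_apply, smul_eq_mul]
    ring
  have hAS : DifferentiableAt ℝ (fun y => G.A p y (G.horizontal ρ k y)) x :=
    ((contDiffAt_A p hx).clm_apply (h.contDiffAt_horizontal k hx)).differentiableAt (by simp)
  have hAR : DifferentiableAt ℝ (fun y => -G.A p y (G.radial t y)) x :=
    ((contDiffAt_A p hx).clm_apply (h.contDiffAt_radial hx)).neg.differentiableAt (by simp)
  have hdρ : DifferentiableAt ℝ (fderiv ℝ ρ) x :=
    differentiableAt_fderiv ((h.smooth_ρ x hx).of_le ENat.LEInfty.out)
  have hdt : DifferentiableAt ℝ (fderiv ℝ t) x :=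
    differentiableAt_fderiv ((h.smooth_t x hx).of_le ENat.LEInfty.out)
  have hclosed := extDerivOne_fderiv ((hΛ.contDiffAt hU).of_le ENat.LEInfty.out) v (G.radial t x)
  rw [extDerivOne_congr hdΛ, extDerivOne_add (hAS.fun_smul hdρ) (hAR.fun_smul hdt),
    extDerivOne_smul hAS hdρ, extDerivOne_smul hAR hdt,
    extDerivOne_fderiv ((h.smooth_ρ x hx).of_le ENat.LEInfty.out),
    extDerivOne_fderiv ((h.smooth_t x hx).of_le ENat.LEInfty.out), ht, hρ, (h.fderiv_radial hx).1,
    (h.fderiv_radial hx).2] at hclosed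
  simpa [h.ρ_ne x hx] using hclosed

theorem exists_A_horizontal_eq (p : Fin N) :
    ∃ C, ∀ x ∈ G.U, G.A p x (G.horizontal ρ k x) = C :=
  h.exists_eq_const
    (fun x hx =>
      ((contDiffAt_A p hx).clm_apply (h.contDiffAt_horizontal k hx)).differentiableAt (by simp))
    (fun x hx => h.fderiv_A_horizontal_frame p (.inl 0) hx)
    (fun x hx => h.fderiv_A_horizontal_frame p (.inl 1) hx)
    (fun _ hx _ => h.fderiv_A_horizontal_eq_zero p hx)

end IsNormalForm

end Horizontal

/-! ### The potentials and the horizon generators -/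

section Potentials

variable {d n N : ℕ} {G : NHEG d n N} {t r : Pt d → ℝ} {k : Fin n → ℝ} {x : Pt d}

theorem gPhiPhi_mulVec (x : Pt d) (y : Fin n → ℝ) :
    G.gPhiPhi x *ᵥ y = fun j => G.g x (G.m j x) (∑ i, y i • G.m i x) := by
  ext j
  simp [gPhiPhi, Matrix.mulVec, dotProduct, mul_comm]

theorem isUnit_det_gPhiPhi (hx : x ∈ G.U) : IsUnit (G.gPhiPhi x).det := by
  rw [isUnit_iff_ne_zero, ne_eq, ← Matrix.exists_mulVec_eq_zero_iff]
  rintro ⟨y, hy, hgy⟩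
  rw [gPhiPhi_mulVec] at hgy
  exact hy (eq_zero_of_forall_sum_m hx fun j => by
    rw [(G.lorentzian x hx).1]
    exact congrFun hgy j)

namespace IsNormalForm

variable (h : G.IsNormalForm t (fun y => (r y)⁻¹) k)
include h

theorem kPot_eq (hx : x ∈ G.U) : G.kPot r x = k := by
  have hk : (fun j => G.g x (G.ξm x) (G.m j x) / r x) = G.gPhiPhi x *ᵥ k := by
    rw [gPhiPhi_mulVec]
    ext j
    have hS := h.horizontal_m hx j
    simp only [horizontal, map_sub, map_smul, sub_apply, smul_apply, smul_eq_mul] at hS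
    rw [(G.lorentzian x hx).1 (G.m j x)]
    linear_combination hS
  rw [kPot, hk, Matrix.mulVec_mulVec, Matrix.nonsing_inv_mul _ (isUnit_det_gPhiPhi hx),
    Matrix.one_mulVec]

theorem ePot_eq (p : Fin N) (hx : x ∈ G.U) :
    G.ePot r p x = -G.A p x (G.horizontal (fun y => (r y)⁻¹) k x) := by
  simp only [ePot, h.kPot_eq hx, horizontal, map_sub, map_sum, map_smul, smul_eq_mul,
    mul_comm (k _)]
  ring

theorem exists_ePot_eq (p : Fin N) : ∃ e, ∀ x ∈ G.U, G.ePot r p x = e :=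
  (h.exists_A_horizontal_eq p).elim fun C hC => ⟨-C, fun x hx => by rw [h.ePot_eq p hx, hC x hx]⟩

end IsNormalForm

theorem IsPoincare.exists_isNormalForm (h : G.IsPoincare t r) :
    ∃ k, G.IsNormalForm t (fun y => (r y)⁻¹) k :=
  h.isHalfPlane.exists_isNormalForm

end Potentials

section Horizon

variable {d n N : ℕ} {G : NHEG d n N} {t ρ : Pt d → ℝ} {k : Fin n → ℝ} {x : Pt d}

theorem nXi_inv {ρ₀ : ℝ} (hρ₀ : ρ₀ ≠ 0) (t₀ : ℝ) (x : Pt d) :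
    ρ₀ • G.nXi t₀ ρ₀⁻¹ x = ((ρ₀ ^ 2 - t₀ ^ 2) / 2) • G.ξm x + t₀ • G.ξ0 x - G.ξp x := by
  simp only [nXi, smul_add, smul_smul, sub_eq_add_neg (_ + _) (G.ξp x), ← neg_one_smul ℝ (G.ξp x)]
  congr 2
  · congr 1
    field_simp
    ring
  · field_simp
  · field_simp

namespace IsNormalForm

variable (h : G.IsNormalForm t ρ k)
include h

theorem nXi_eq (hx : x ∈ G.U) : G.nXi (t x) (ρ x)⁻¹ x = ∑ i, k i • G.m i x := by
  refine smul_right_injective _ (h.ρ_ne x hx) ?_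
  simp only [nXi_inv (h.ρ_ne x hx), h.ξp_eq x hx]
  module

theorem zetaH_eq {ρ₀ : ℝ} (hρ₀ : ρ₀ ≠ 0) (t₀ : ℝ) (hx : x ∈ G.U) :
    (2 * ρ₀ * ρ x) • G.zetaH k t₀ ρ₀⁻¹ x =
      (2 * ρ x * (t x - t₀)) • G.radial t x -
        ((t x - t₀) ^ 2 + ρ x ^ 2 - ρ₀ ^ 2) • G.horizontal ρ k x -
        ((t x - t₀) ^ 2 - (ρ x - ρ₀) ^ 2) • ∑ i, k i • G.m i x := by
  have hn := nXi_inv (G := G) hρ₀ t₀ x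
  rw [h.ξp_eq x hx] at hn
  simp only [zetaH, radial, horizontal]
  linear_combination (norm := module) (2 * ρ x) • hn

end IsNormalForm

end Horizon

/-! ### The surface gravity -/

section SurfaceGravity

variable {d n N : ℕ} {G : NHEG d n N} {t ρ : Pt d → ℝ} {k : Fin n → ℝ} {x : Pt d} {ε t₀ ρ₀ : ℝ}

/-- The null coordinate `t + ε ρ` of `AdS₂`, for `ε = ±1`. -/
def nullCoord (ε : ℝ) (t ρ : Pt d → ℝ) : Pt d → ℝ := fun x => t x + ε * ρ x

variable (G) in
/-- The function `f` in the decomposition `ζ_♭ = f dτ + (τ - τ₀) β` of the horizon generator, where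
`τ = nullCoord ε t ρ` and `τ₀ = t₀ + ε ρ₀`. -/
def horizonFactor (t ρ : Pt d → ℝ) (t₀ ρ₀ : ℝ) : Pt d → ℝ :=
  fun x => G.conformalFactor t ρ x * ((t x - t₀) ^ 2 + ρ x ^ 2 - ρ₀ ^ 2) * (2 * ρ₀)⁻¹

variable (G) in
/-- The 1-form `β` in the decomposition `ζ_♭ = f dτ + (τ - τ₀) β` of the horizon generator, where
`τ = nullCoord ε t ρ` and `τ₀ = t₀ + ε ρ₀`. -/
def horizonForm (k : Fin n → ℝ) (ε : ℝ) (t ρ : Pt d → ℝ) (t₀ ρ₀ : ℝ) : OneForm d := fun x =>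
  -(ε * G.conformalFactor t ρ x * (nullCoord ε t ρ x - (t₀ - ε * ρ₀)) * (2 * ρ₀)⁻¹) •
      fderiv ℝ ρ x -
    ((nullCoord (-ε) t ρ x - (t₀ - ε * ρ₀)) * (2 * ρ₀ * ρ x)⁻¹) • G.g x (∑ i, k i • G.m i x)

namespace IsHalfPlane

variable (h : G.IsHalfPlane t ρ)
include h

theorem contDiffAt_nullCoord (ε : ℝ) (hx : x ∈ G.U) : ContDiffAt ℝ ∞ (nullCoord ε t ρ) x :=
  (h.smooth_t x hx).add (contDiffAt_const.mul (h.smooth_ρ x hx))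

theorem fderiv_nullCoord (ε : ℝ) (hx : x ∈ G.U) :
    fderiv ℝ (nullCoord ε t ρ) x = fderiv ℝ t x + ε • fderiv ℝ ρ x := by
  have hρ := h.differentiableAt_ρ hx
  unfold nullCoord
  rw [fderiv_fun_add (h.differentiableAt_t hx) (hρ.const_mul ε), fderiv_const_mul hρ]

theorem fderiv_horizonFactor (t₀ ρ₀ : ℝ) (hx : x ∈ G.U) (v : Pt d) :
    fderiv ℝ (G.horizonFactor t ρ t₀ ρ₀) x v =
      (fderiv ℝ (G.conformalFactor t ρ) x v * ((t x - t₀) ^ 2 + ρ x ^ 2 - ρ₀ ^ 2) +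
        G.conformalFactor t ρ x * (2 * (t x - t₀) * fderiv ℝ t x v + 2 * ρ x * fderiv ℝ ρ x v)) *
        (2 * ρ₀)⁻¹ := by
  have hw := ((h.contDiffAt_conformalFactor hx).differentiableAt (by simp)).hasFDerivAt
  have hN := (((h.differentiableAt_t hx).hasFDerivAt.sub_const t₀).pow 2).add
    ((h.differentiableAt_ρ hx).hasFDerivAt.pow 2) |>.sub_const (ρ₀ ^ 2)
  have hf : HasFDerivAt (G.horizonFactor t ρ t₀ ρ₀) _ x := (hw.mul hN).mul_const (2 * ρ₀)⁻¹
  rw [hf.fderiv]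
  simp only [add_apply, Pi.add_apply, smul_apply, smul_add, smul_eq_mul, nsmul_eq_mul,
    Nat.add_one_sub_one, Nat.cast_ofNat, pow_one]
  ring

theorem differentiableAt_horizonFactor (t₀ ρ₀ : ℝ) (hx : x ∈ G.U) :
    DifferentiableAt ℝ (G.horizonFactor t ρ t₀ ρ₀) x := by
  have hw := (h.contDiffAt_conformalFactor hx).differentiableAt (by simp)
  have ht := h.differentiableAt_t hx
  have hρ := h.differentiableAt_ρ hx
  unfold horizonFactor
  fun_prop

theorem differentiableAt_horizonForm (k : Fin n → ℝ) (ε t₀ : ℝ) (hρ₀ : ρ₀ ≠ 0) (hx : x ∈ G.U) :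
    DifferentiableAt ℝ (G.horizonForm k ε t ρ t₀ ρ₀) x := by
  have hw := (h.contDiffAt_conformalFactor hx).differentiableAt (by simp)
  have hτ := fun ε => (h.contDiffAt_nullCoord ε hx).differentiableAt (by simp)
  have hρ := h.differentiableAt_ρ hx
  have hdρ := differentiableAt_fderiv ((h.smooth_ρ x hx).of_le ENat.LEInfty.out)
  have hK : DifferentiableAt ℝ (fun y => G.g y (∑ i, k i • G.m i y)) x :=
    ((contDiffAt_g hx).clm_apply (contDiffAt_sum_m k hx)).differentiableAt (by simp)
  have hinv : DifferentiableAt ℝ (fun y => (2 * ρ₀ * ρ y)⁻¹) x :=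
    (hρ.const_mul (2 * ρ₀)).fun_inv (mul_ne_zero (mul_ne_zero two_ne_zero hρ₀) (h.ρ_ne x hx))
  unfold horizonForm
  fun_prop

end IsHalfPlane

namespace IsNormalForm

variable (h : G.IsNormalForm t ρ k)
include h

theorem lower_zetaH (hε : ε ^ 2 = 1) (hρ₀ : ρ₀ ≠ 0) (t₀ : ℝ) (hx : x ∈ G.U) :
    lower G.g (G.zetaH k t₀ ρ₀⁻¹) x =
      G.horizonFactor t ρ t₀ ρ₀ x • fderiv ℝ (nullCoord ε t ρ) x +
        (nullCoord ε t ρ x - (t₀ + ε * ρ₀)) • G.horizonForm k ε t ρ t₀ ρ₀ x := by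
  have hρ := h.ρ_ne x hx
  have hζ := congrArg (G.g x) (h.zetaH_eq hρ₀ t₀ hx)
  rw [map_sub, map_sub, map_smul, map_smul, map_smul, map_smul, h.g_radial hx,
    h.g_horizontal hx] at hζ
  refine smul_right_injective _ (mul_ne_zero (mul_ne_zero two_ne_zero hρ₀) hρ) (hζ.trans ?_)
  ext v
  simp only [horizonFactor, horizonForm, h.fderiv_nullCoord ε hx, nullCoord, add_apply, sub_apply,
    smul_apply, smul_eq_mul]
  field_simp
  linear_combination ((2 * ρ x * (t x - t₀) + ε * (ρ x ^ 2 - ρ₀ ^ 2)) * ρ x *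
    G.conformalFactor t ρ x * fderiv ℝ ρ x v -
    (ρ x - ρ₀) ^ 2 * G.g x (∑ i, k i • G.m i x) v) * hε

theorem g_null (hε : ε ^ 2 = 1) (hx : x ∈ G.U) :
    G.g x (G.radial t x + ε • G.horizontal ρ k x) =
      -(ε * (ρ x * G.conformalFactor t ρ x)) • fderiv ℝ (nullCoord ε t ρ) x := by
  rw [map_add, map_smul, h.g_radial hx, h.g_horizontal hx, h.fderiv_nullCoord ε hx]
  linear_combination (norm := module) (ρ x * G.conformalFactor t ρ x) • hε • fderiv ℝ ρ x

theorem fderiv_horizonFactor_null (hε : ε ^ 2 = 1) (hρ₀ : ρ₀ ≠ 0) (hx : x ∈ G.U)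
    (hτ : nullCoord ε t ρ x = t₀ + ε * ρ₀) :
    fderiv ℝ (G.horizonFactor t ρ t₀ ρ₀) x (G.radial t x + ε • G.horizontal ρ k x) =
      -(ρ x * G.conformalFactor t ρ x) := by
  have ht : t x = t₀ + ε * ρ₀ - ε * ρ x := by
    rw [← hτ, nullCoord]
    ring
  simp only [h.fderiv_horizonFactor t₀ ρ₀ hx, map_add, map_smul, (h.fderiv_radial hx).1,
    (h.fderiv_radial hx).2, (h.fderiv_horizontal k hx).1, (h.fderiv_horizontal k hx).2,
    h.fderiv_conformalFactor_radial hx, h.fderiv_conformalFactor_horizontal k hx, smul_eq_mul, ht]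
  field_simp
  linear_combination (2 * G.conformalFactor t ρ x * ρ₀ * (ρ₀ - ρ x)) * hε

theorem horizonForm_null (hε : ε ^ 2 = 1) (hρ₀ : ρ₀ ≠ 0) (hx : x ∈ G.U)
    (hτ : nullCoord ε t ρ x = t₀ + ε * ρ₀) :
    G.horizonForm k ε t ρ t₀ ρ₀ x (G.radial t x + ε • G.horizontal ρ k x) =
      ρ x * G.conformalFactor t ρ x := by
  have hK : G.g x (∑ i, k i • G.m i x) (G.radial t x + ε • G.horizontal ρ k x) = 0 := by
    rw [(G.lorentzian x hx).1]
    exact apply_sum_m_eq_zero (by simp [h.radial_m hx, h.horizontal_m hx]) k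
  have hdρ : fderiv ℝ ρ x (G.radial t x + ε • G.horizontal ρ k x) = -ρ x := by
    simp [(h.fderiv_radial hx).2, (h.fderiv_horizontal k hx).2]
  simp only [horizonForm, hτ, sub_apply, smul_apply, hK, hdρ, smul_eq_mul]
  have hρ := h.ρ_ne x hx
  field_simp
  linear_combination (2 * G.conformalFactor t ρ x * ρ₀ * ρ x ^ 2) * hε

theorem extDerivSq_zetaH (hε : ε ^ 2 = 1) (hρ₀ : ρ₀ ≠ 0) (hx : x ∈ G.U)
    (hτ : nullCoord ε t ρ x = t₀ + ε * ρ₀) :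
    extDerivSq G.g (G.zetaH k t₀ ρ₀⁻¹) x = -8 := by
  have hρ := h.ρ_ne x hx
  have hw := h.conformalFactor_ne_zero hx
  set L := G.radial t x + ε • G.horizontal ρ k x
  set ℓ := -(ε * (ρ x * G.conformalFactor t ρ x)⁻¹) • L
  set α := fderiv ℝ (G.horizonFactor t ρ t₀ ρ₀) x - G.horizonForm k ε t ρ t₀ ρ₀ x
  have hgℓ : G.g x ℓ = fderiv ℝ (nullCoord ε t ρ) x := by
    rw [map_smul, h.g_null hε hx, smul_smul]
    convert one_smul ℝ _
    field_simp
    exact hε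
  have hnull : G.g x ℓ ℓ = 0 := by
    simp only [hgℓ, h.fderiv_nullCoord ε hx, ℓ, L, add_apply, smul_apply, map_smul, map_add,
      smul_eq_mul, (h.fderiv_radial hx).1, (h.fderiv_radial hx).2, (h.fderiv_horizontal k hx).1,
      (h.fderiv_horizontal k hx).2]
    ring
  have hαℓ : α ℓ = 2 * ε := by
    simp only [α, ℓ, L, map_smul, sub_apply, h.fderiv_horizonFactor_null hε hρ₀ hx hτ,
      h.horizonForm_null hε hρ₀ hx hτ, smul_eq_mul]
    field_simp
    ring
  rw [extDerivSq_eq_of_wedge_null (G.lorentzian x hx) (α := α) hnull fun v w => ?_, hαℓ, mul_pow,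
    hε]
  · norm_num
  · rw [hgℓ]
    exact extDerivOne_smul_fderiv_add_smul (h.differentiableAt_horizonFactor t₀ ρ₀ hx)
      ((h.contDiffAt_nullCoord ε hx).of_le ENat.LEInfty.out)
      (h.differentiableAt_horizonForm k ε t₀ hρ₀ hx)
      (Filter.eventually_of_mem (G.isOpen_U.mem_nhds hx) fun y hy => h.lower_zetaH hε hρ₀ t₀ hy)
      hτ v w

end IsNormalForm

theorem IsNormalForm.surfaceGravity_zetaH {r : Pt d → ℝ} {r₀ : ℝ}
    (h : G.IsNormalForm t (fun y => (r y)⁻¹) k) (hr₀ : r₀ ≠ 0) (hx : x ∈ G.horizon t r t₀ r₀) :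
    surfaceGravity G.g (G.zetaH k t₀ r₀) x = 1 := by
  obtain ⟨hxU, hτ⟩ := hx
  have hsq : extDerivSq G.g (G.zetaH k t₀ r₀) x = -8 := by
    rw [← inv_inv r₀]
    simp only [one_div] at hτ
    rcases hτ with hτ | hτ
    · exact h.extDerivSq_zetaH (ε := 1) (by norm_num) (inv_ne_zero hr₀) hxU
        (by simpa [nullCoord] using hτ)
    · exact h.extDerivSq_zetaH (ε := -1) (by norm_num) (inv_ne_zero hr₀) hxU
        (by simpa [nullCoord, sub_eq_add_neg] using hτ)
  rw [surfaceGravity, hsq]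
  norm_num

end SurfaceGravity
end NHEG

end NearHorizon

end

theorem mainTheorem6 {d n N : ℕ} (G : NearHorizon.NHEG d n N) :
    (∃ t r : NearHorizon.Pt d → ℝ, G.IsPoincare t r ∧ ∀ x ∈ G.U, 0 < r x) ∧
    ∀ t r : NearHorizon.Pt d → ℝ, G.IsPoincare t r →
      ∃ (k : Fin n → ℝ) (e : Fin N → ℝ),
        (∀ x ∈ G.U, G.kPot r x = k) ∧
        (∀ p, ∀ x ∈ G.U, G.ePot r p x = e p) ∧
        (∀ x ∈ G.U, G.nXi (t x) (r x) x = ∑ i, k i • G.m i x) ∧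
        ∀ tH rH : ℝ, rH ≠ 0 → ∀ x ∈ G.horizon t r tH rH,
          NearHorizon.surfaceGravity G.g (G.zetaH k tH rH) x = 1 := by
  refine ⟨?_, fun t r hP => ?_⟩
  · obtain ⟨a, b, c, hO⟩ := G.exists_orbitCoeffs
    exact ⟨_, _, hO.isHalfPlane.isPoincare,
      fun x hx => inv_pos.2 (Real.sqrt_pos.2 (hO.discr_pos hx))⟩
  · obtain ⟨k, h⟩ := hP.exists_isNormalForm
    choose e he using h.exists_ePot_eq
    exact ⟨k, e, fun x hx => h.kPot_eq hx, he, fun x hx => by simpa using h.nXi_eq hx,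
      fun tH rH hrH x hx => h.surfaceGravity_zetaH hrH hx⟩
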